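/- Let $q$ be a real number with $q\notin\{0,1,-1\}$ and put $[n]_q=\frac{1-q^n}{1-q}$. Let $\{Q_n\}_{n\ge 0}$ be a sequence of real polynomials with $\deg Q_n=n$ for every $n$ and $Q_0=1$. The sequence is called *$q$-Appell of type II* if $\frac{Q_n(x)-Q_n(qx)}{(1-q)x}=[n]_q\,Q_{n-1}(qx)$ for all $n\ge 0$ (the right-hand side being $0$ for $n=0$). It is called *quasi-orthogonal* if there are a (possibly infinite) interval $(a,b)$ and a non-decreasing function $\varphi$ with finite moments such that $\int_a^b x^mQ_n(x)\,d\varphi(x)$ is $0$ for $0\le m\le n-2$, is nonzero for $0\le m=n-1$, and is nonzero for $m=n=0$. For $a\ne 0$ let $$V_n^{(a)}(x;q)=(-a)^n q^{-\binom n2}\sum_{k=0}^{n}\frac{(q^{-n};q)_k\,(x;q)_k}{(q;q)_k}\,\frac{(-1)^k}{q^{\binom k2}}\left(\frac{q^n}{a}\right)^k,\qquad (c;q)_k=\prod_{j=0}^{k-1}(1-cq^j),$$ be the Al-Salam--Carlitz II polynomials. Then the following are equivalent. 1. $\{Q_n\}$ is quasi-orthogonal and $q$-Appell of type II. 2. There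 are constants $\alpha,\beta\in\mathbb C$ and $\lambda\in\mathbb R$ with $\beta\neq 0$, $\lambda\ne 0$, $\alpha+\beta\in\mathbb R$, $\alpha\beta\in\mathbb R$ and $q(1-q^n)\,\alpha\beta>0$ for all $n\ge 1$ (for $0<q<1$ this says $\alpha\beta>0$), such that for all $n\ge 1$ $$Q_n(x)=\beta^n q^{\binom n2}\,V_n^{(\alpha/\beta)}\!\left(\frac x\beta;q\right)-\frac{\beta^{n-1}q^{\binom{n-1}2}\,[n]_q}{\lambda}\,V_{n-1}^{(\alpha/\beta)}\!\left(\frac x\beta;q\right).$$ -/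

import Mathlib

open Polynomial MeasureTheory

/-- The `q`-number `[n]_q = (1 - q^n) / (1 - q)`. -/
noncomputable def qNumber (q : ℝ) (n : ℕ) : ℝ := (1 - q ^ n) / (1 - q)

/-- The `q`-derivative `D_q f(x) = (f(x) - f(qx)) / ((1 - q) x)` (meaningful for `x ≠ 0`, `q ≠ 1`). -/
noncomputable def qDeriv (q : ℝ) (f : ℝ → ℝ) (x : ℝ) : ℝ :=
  (f x - f (q * x)) / ((1 - q) * x)

/-- A polynomial set: a sequence of real polynomials, the `n`-th one of exact degree `n`. -/
def IsPolynomialSet (Q : ℕ → ℝ[X]) : Prop := ∀ n, (Q n).degree = n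

/-- A `q`-Appell set of type II: a polynomial set with `D_q Q_n(x) = [n]_q Q_{n-1}(qx)` for all `n`.
For `n = 0` the right-hand side is `0` because `[0]_q = 0`. The identity is asked for at the points
`x ≠ 0`, which determines both sides as polynomials. -/
def IsQAppellII (q : ℝ) (Q : ℕ → ℝ[X]) : Prop :=
  IsPolynomialSet Q ∧
    ∀ n : ℕ, ∀ x : ℝ, x ≠ 0 →
      qDeriv q (fun y => (Q n).eval y) x = qNumber q n * (Q (n - 1)).eval (q * x)

/-- The Lebesgue-Stieltjes measure `dφ` of a non-decreasing function `φ` on the interval `(a, b)`,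
whose end points may be infinite. -/
noncomputable def distributionOn (a b : EReal) (φ : ℝ → ℝ) (hφ : Monotone φ) : Measure ℝ :=
  hφ.stieltjesFunction.measure.restrict {x : ℝ | a < (x : EReal) ∧ (x : EReal) < b}

/-- A polynomial set `Q` is quasi-orthogonal if there are an interval `(a, b)` and a non-decreasing
function `φ`, with finite moments, such that `∫ x^m Q_n(x) dφ(x)` over `(a, b)` is zero for
`0 ≤ m ≤ n - 2`, nonzero for `0 ≤ m = n - 1`, and nonzero for `m = n = 0`. -/
def IsQuasiOrthogonal (Q : ℕ → ℝ[X]) : Prop :=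
  IsPolynomialSet Q ∧
    ∃ (a b : EReal) (φ : ℝ → ℝ) (hφ : Monotone φ), a < b ∧
      (∀ k : ℕ, Integrable (fun x : ℝ => x ^ k) (distributionOn a b φ hφ)) ∧
      (∀ m n : ℕ, m + 2 ≤ n → ∫ x, x ^ m * (Q n).eval x ∂(distributionOn a b φ hφ) = 0) ∧
      (∀ m n : ℕ, m + 1 = n → ∫ x, x ^ m * (Q n).eval x ∂(distributionOn a b φ hφ) ≠ 0) ∧
      ∫ x, (Q 0).eval x ∂(distributionOn a b φ hφ) ≠ 0

/-- The `q`-Pochhammer symbol `(a; q)_n = ∏_{k=0}^{n-1} (1 - a q^k)`. -/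
noncomputable def qPochhammer (a q : ℂ) (n : ℕ) : ℂ := ∏ k ∈ Finset.range n, (1 - a * q ^ k)

/-- The Al-Salam-Carlitz II polynomial, for `a ≠ 0` and `q` neither zero nor a root of unity,
`V_n^{(a)}(x; q) = (-a)^n q^{-n(n-1)/2} ₂φ₀(q^{-n}, x; -; q, q^n / a)`, the terminating basic
hypergeometric series `₂φ₀(c, d; -; q, z)` being
`∑_k (c; q)_k (d; q)_k / (q; q)_k * ((-1)^k q^{k(k-1)/2})^{-1} * z^k`. -/
noncomputable def alSalamCarlitzII (a : ℂ) (n : ℕ) (x q : ℂ) : ℂ :=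
  (-a) ^ n * (q ^ n.choose 2)⁻¹ *
    ∑ k ∈ Finset.range (n + 1),
      qPochhammer ((q ^ n)⁻¹) q k * qPochhammer x q k / qPochhammer q q k *
        ((-1) ^ k * q ^ k.choose 2)⁻¹ * (q ^ n / a) ^ k

/-! Put s = α + β and p = αβ. Up to the scaling in the statement, the Al-Salam-Carlitz II
polynomials are the real polynomials A_n with A_0 = 1 and A_{n+1} = (q^n x - s) A_n - p (1 - q^n)
A_{n-1} (`alSalamCarlitzII_eq_ascPoly`). So condition 2 says Q_n = A_n + a (1 - q^n) A_{n-1} with a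
real and nonzero and q (1 - q^n) p > 0.

From 2 to 1: A_n satisfies the q-Appell relation and the combination inherits it. The functional
that kills A_n for n ≥ 1 gives the A_n positive square norms, so it is nonnegative on squares, and
the Hamburger moment problem (`exists_measure_of_map_mul_self_nonneg`) turns it into a measure.

From 1 to 2: quasi-orthogonality gives Q_n = P_n + e_n P_{n-1} with P_n orthogonal
(`exists_orthogonal_of_quasiOrthogonal`). Since Q_{n+1} - q^n x Q_n obeys the same lowering relation
as Q_n, it is a combination of Q_0, ..., Q_n whose coefficients come from a single sequence h
(`IsQLowering.exists_recurrence`). Pairing with P_j yields h_{k+1} (1 - q^{j+1}) + h_k e_{j+1} = 0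
for k ≥ 2. If h_2 ≠ 0, then e_n is proportional to 1 - q^n, so P_n is q-Appell as well and, being
orthogonal, is some A_n. If h_2 = 0, then h_k = 0 for all k ≥ 2 and Q_n itself is an A_n;
`ascPoly_shift` splits it into two terms, provided that s² ≥ 4p and p (1 - q^n) > 0. These
inequalities (`ascPoly_parameter_conditions`) follow from the positive norms of P_n through a
Riccati-type recurrence (`sign_of_positive_recurrence`). -/

/-! ### The Al-Salam-Carlitz II polynomials through their three-term recurrence -/

/-- The Gaussian binomial coefficient `[n choose k]_q`. -/
noncomputable def gaussCoeff (q : ℂ) (n k : ℕ) : ℂ :=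
  ∏ j ∈ Finset.range k, (1 - q ^ n * (q ^ j)⁻¹) / (1 - q ^ (j + 1))

theorem gaussCoeff_succ_right (q : ℂ) (n k : ℕ) :
    gaussCoeff q n (k + 1) = gaussCoeff q n k * ((1 - q ^ n * (q ^ k)⁻¹) / (1 - q ^ (k + 1))) := by
  rw [gaussCoeff, Finset.prod_range_succ, ← gaussCoeff]

theorem gaussCoeff_succ_succ {q : ℂ} (hq : q ≠ 0) (n k : ℕ) :
    gaussCoeff q (n + 1) (k + 1) =
      gaussCoeff q n k * ((1 - q ^ (n + 1)) / (1 - q ^ (k + 1))) := by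
  induction k with
  | zero => simp [gaussCoeff]
  | succ k ih =>
    rw [gaussCoeff_succ_right, ih, gaussCoeff_succ_right q n k]
    have : q ^ (n + 1) * (q ^ (k + 1))⁻¹ = q ^ n * (q ^ k)⁻¹ := by
      field_simp
      ring
    rw [this]
    ring

theorem gaussCoeff_self_succ {q : ℂ} (hq : q ≠ 0) (n : ℕ) : gaussCoeff q n (n + 1) = 0 := by
  rw [gaussCoeff_succ_right, mul_inv_cancel₀ (pow_ne_zero _ hq)]
  simp

theorem one_sub_pow_ne_zero_of {K : Type*} [Ring K] {q : K} (hq1 : ∀ n : ℕ, 1 ≤ n → q ^ n ≠ 1)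
    (k : ℕ) : 1 - q ^ (k + 1) ≠ 0 :=
  sub_ne_zero.2 (hq1 _ (Nat.succ_pos k)).symm

theorem gaussCoeff_pascal {q : ℂ} (hq : q ≠ 0) (hq1 : ∀ n : ℕ, 1 ≤ n → q ^ n ≠ 1) (n k : ℕ) :
    gaussCoeff q (n + 1) (k + 1) =
      q ^ n * (q ^ k)⁻¹ * gaussCoeff q n k + gaussCoeff q n (k + 1) := by
  have h := one_sub_pow_ne_zero_of hq1 k
  rw [gaussCoeff_succ_succ hq, gaussCoeff_succ_right]
  field_simp
  ring

theorem gaussCoeff_absorb {q : ℂ} (hq : q ≠ 0) (n k : ℕ) :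
    (1 - q ^ (n + 1) * (q ^ k)⁻¹) * gaussCoeff q (n + 1) k =
      (1 - q ^ (n + 1)) * gaussCoeff q n k := by
  cases k with
  | zero => simp [gaussCoeff]
  | succ k =>
    rw [gaussCoeff_succ_succ hq, gaussCoeff_succ_right]
    have : q ^ (n + 1) * (q ^ (k + 1))⁻¹ = q ^ n * (q ^ k)⁻¹ := by
      field_simp
      ring
    rw [this]
    ring

theorem gaussCoeff_eq_qPochhammer {q : ℂ} (hq : q ≠ 0) (n k : ℕ) :
    qPochhammer ((q ^ n)⁻¹) q k / qPochhammer q q k * ((-1) ^ k * q ^ k.choose 2)⁻¹ * (q ^ n) ^ k =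
      gaussCoeff q n k := by
  induction k with
  | zero => simp [gaussCoeff, qPochhammer]
  | succ k ih =>
    have hc : (k + 1).choose 2 = k + k.choose 2 := by
      rw [Nat.choose_succ_succ' k 1, Nat.choose_one_right]
    have e : ∀ a : ℂ, qPochhammer a q (k + 1) = qPochhammer a q k * (1 - a * q ^ k) := fun a => by
      rw [qPochhammer, Finset.prod_range_succ, ← qPochhammer]
    rw [gaussCoeff_succ_right, ← ih, e, e, hc, pow_add q k, pow_succ (q ^ n) k, pow_succ (-1 : ℂ) k]
    have h1 : (1 - (q ^ n)⁻¹ * q ^ k) * q ^ n = -(1 - q ^ n * (q ^ k)⁻¹) * q ^ k := by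
      field_simp
      ring
    have h2 : (q ^ k)⁻¹ * q ^ k = 1 := inv_mul_cancel₀ (pow_ne_zero _ hq)
    have h3 : q * q ^ k = q ^ (k + 1) := by ring
    rw [h3, div_eq_mul_inv, div_eq_mul_inv, div_eq_mul_inv, mul_inv, mul_inv, mul_inv, mul_inv,
      mul_inv]
    have h4 : ((-1 : ℂ))⁻¹ = -1 := by norm_num
    rw [h4]
    linear_combination
      (qPochhammer (q ^ n)⁻¹ q k * (qPochhammer q q k)⁻¹ * (1 - q ^ (k + 1))⁻¹ * ((-1) ^ k)⁻¹ *
        (q ^ k.choose 2)⁻¹ * (q ^ n) ^ k) * (-(q ^ k)⁻¹ * h1 + (1 - q ^ n * (q ^ k)⁻¹) * h2)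

/-- The summands of `β ^ n * q ^ (n choose 2) * V_n^{(α/β)}(x / β; q)`. -/
noncomputable def alSalamCarlitzTerm (q α β x : ℂ) (n k : ℕ) : ℂ :=
  gaussCoeff q n k * ((-α) ^ n * ((-α) ^ k)⁻¹) * ∏ j ∈ Finset.range k, (q ^ j * x - β)

/-- The q-Pascal rule, with the last factor q^k x - β of the product split: q^{n-k} · q^k = q^n
removes k from the coefficient of x. -/
theorem alSalamCarlitzTerm_succ {q α : ℂ} (β x : ℂ) (hq : q ≠ 0)
    (hq1 : ∀ n : ℕ, 1 ≤ n → q ^ n ≠ 1) (hα : α ≠ 0) (n k : ℕ) :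
    alSalamCarlitzTerm q α β x (n + 1) (k + 1) =
      q ^ n * x * alSalamCarlitzTerm q α β x n k -
        β * (q ^ n * (q ^ k)⁻¹ * alSalamCarlitzTerm q α β x n k) -
          α * alSalamCarlitzTerm q α β x n (k + 1) := by
  obtain ⟨a, rfl⟩ : ∃ a, α = -a := ⟨-α, (neg_neg α).symm⟩
  have ha : a ≠ 0 := neg_ne_zero.1 hα
  unfold alSalamCarlitzTerm
  rw [gaussCoeff_pascal hq hq1, Finset.prod_range_succ, neg_neg]
  field_simp
  ring_nf

theorem alSalamCarlitzTerm_absorb {q : ℂ} (α β x : ℂ) (hq : q ≠ 0) (n k : ℕ) :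
    q ^ (n + 1) * (q ^ k)⁻¹ * alSalamCarlitzTerm q α β x (n + 1) k =
      alSalamCarlitzTerm q α β x (n + 1) k +
        α * (1 - q ^ (n + 1)) * alSalamCarlitzTerm q α β x n k := by
  unfold alSalamCarlitzTerm
  linear_combination (-(((-α) ^ (n + 1) * ((-α) ^ k)⁻¹) *
    ∏ j ∈ Finset.range k, (q ^ j * x - β))) * gaussCoeff_absorb hq n k

theorem alSalamCarlitzTerm_self_succ {q : ℂ} (α β x : ℂ) (hq : q ≠ 0) (n : ℕ) :
    alSalamCarlitzTerm q α β x n (n + 1) = 0 := by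
  simp [alSalamCarlitzTerm, gaussCoeff_self_succ hq]

/-- The value `β ^ n * q ^ (n choose 2) * V_n^{(α/β)}(x / β; q)` as a sum of Gaussian type. -/
noncomputable def alSalamCarlitzSum (q α β x : ℂ) (n : ℕ) : ℂ :=
  ∑ k ∈ Finset.range (n + 1), alSalamCarlitzTerm q α β x n k

theorem alSalamCarlitzSum_zero (q α β x : ℂ) : alSalamCarlitzSum q α β x 0 = 1 := by
  simp [alSalamCarlitzSum, alSalamCarlitzTerm, gaussCoeff]

theorem sum_weighted_alSalamCarlitzTerm {q : ℂ} (α β x : ℂ) (hq : q ≠ 0) (n : ℕ) :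
    ∑ k ∈ Finset.range (n + 1), q ^ n * (q ^ k)⁻¹ * alSalamCarlitzTerm q α β x n k =
      alSalamCarlitzSum q α β x n + α * (1 - q ^ n) * alSalamCarlitzSum q α β x (n - 1) := by
  cases n with
  | zero => simp [alSalamCarlitzSum]
  | succ n =>
    simp only [alSalamCarlitzTerm_absorb α β x hq n, Finset.sum_add_distrib, ← Finset.mul_sum]
    rw [Finset.sum_range_succ (fun k => alSalamCarlitzTerm q α β x n k),
      alSalamCarlitzTerm_self_succ α β x hq, add_zero]
    rfl

/-- Summing the termwise relation leaves a sum weighted by q^{n-k}; the absorption identity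
evaluates it, and this is where the index n - 1 enters. -/
theorem alSalamCarlitzSum_succ {q α : ℂ} (β x : ℂ) (hq : q ≠ 0)
    (hq1 : ∀ n : ℕ, 1 ≤ n → q ^ n ≠ 1) (hα : α ≠ 0) (n : ℕ) :
    alSalamCarlitzSum q α β x (n + 1) =
      (q ^ n * x - (α + β)) * alSalamCarlitzSum q α β x n -
        α * β * (1 - q ^ n) * alSalamCarlitzSum q α β x (n - 1) := by
  have h0 : alSalamCarlitzTerm q α β x (n + 1) 0 = -α * alSalamCarlitzTerm q α β x n 0 := by
    simp [alSalamCarlitzTerm, gaussCoeff, pow_succ, mul_comm]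
  have h1 : ∑ k ∈ Finset.range (n + 1), alSalamCarlitzTerm q α β x n (k + 1) +
      alSalamCarlitzTerm q α β x n 0 = alSalamCarlitzSum q α β x n := by
    rw [← Finset.sum_range_succ', Finset.sum_range_succ, alSalamCarlitzTerm_self_succ α β x hq,
      add_zero, alSalamCarlitzSum]
  rw [alSalamCarlitzSum, Finset.sum_range_succ']
  simp only [alSalamCarlitzTerm_succ β x hq hq1 hα, Finset.sum_sub_distrib, ← Finset.mul_sum]
  rw [sum_weighted_alSalamCarlitzTerm α β x hq, ← alSalamCarlitzSum, h0]
  linear_combination (-α) * h1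

theorem alSalamCarlitzII_eq_sum {q α β : ℂ} (x : ℂ) (hq : q ≠ 0) (hα : α ≠ 0) (hβ : β ≠ 0)
    (n : ℕ) :
    β ^ n * q ^ n.choose 2 * alSalamCarlitzII (α / β) n (x / β) q =
      alSalamCarlitzSum q α β x n := by
  have hc : q ^ n.choose 2 ≠ 0 := pow_ne_zero _ hq
  have hn : β ^ n * q ^ n.choose 2 * ((-(α / β)) ^ n * (q ^ n.choose 2)⁻¹) = (-α) ^ n := by
    rw [← neg_div, div_pow]
    field_simp
  rw [alSalamCarlitzII, alSalamCarlitzSum, ← mul_assoc, hn, Finset.mul_sum]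
  refine Finset.sum_congr rfl fun k _ => ?_
  have hp : ∏ j ∈ Finset.range k, (q ^ j * x - β) = (-β) ^ k * qPochhammer (x / β) q k := by
    rw [qPochhammer, show (-β) ^ k = ∏ _j ∈ Finset.range k, (-β) by simp, ← Finset.prod_mul_distrib]
    refine Finset.prod_congr rfl fun j _ => ?_
    field_simp
    ring
  rw [alSalamCarlitzTerm, hp, ← gaussCoeff_eq_qPochhammer hq, div_pow, div_pow, div_div_eq_mul_div]
  have h2 : (-β) ^ k * ((-α) ^ k)⁻¹ = β ^ k / α ^ k := by
    rw [neg_pow β, neg_pow α]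
    have : (-1 : ℂ) ^ k ≠ 0 := pow_ne_zero _ (by norm_num)
    field_simp
  linear_combination (-((-α) ^ n * (qPochhammer (q ^ n)⁻¹ q k * qPochhammer (x / β) q k /
    qPochhammer q q k) * ((-1) ^ k * q ^ k.choose 2)⁻¹ * (q ^ n) ^ k)) * h2

/-- The real polynomials with `A_{n+1} = (q^n X - s) A_n - p (1 - q^n) A_{n-1}` and `A_0 = 1`. -/
noncomputable def ascPoly (q s p : ℝ) : ℕ → ℝ[X]
  | 0 => 1
  | 1 => X - C s
  | n + 2 => (C (q ^ (n + 1)) * X - C s) * ascPoly q s p (n + 1) -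
      C (p * (1 - q ^ (n + 1))) * ascPoly q s p n

theorem ascPoly_succ (q s p : ℝ) (n : ℕ) :
    ascPoly q s p (n + 1) = (C (q ^ n) * X - C s) * ascPoly q s p n -
      C (p * (1 - q ^ n)) * ascPoly q s p (n - 1) := by
  cases n with
  | zero => simp [ascPoly]
  | succ n => rfl

/-- A sequence satisfying a recurrence of order two with vanishing initial coefficient is
determined by its initial value. -/
theorem eq_of_recurrence {R : Type*} [CommRing R] {u v : ℕ → R} {a b : ℕ → R} (hb : b 0 = 0)
    (h0 : u 0 = v 0) (hu : ∀ n, u (n + 1) = a n * u n - b n * u (n - 1))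
    (hv : ∀ n, v (n + 1) = a n * v n - b n * v (n - 1)) (n : ℕ) : u n = v n := by
  induction n using Nat.strong_induction_on with
  | _ n ih =>
    cases n with
    | zero => exact h0
    | succ n =>
      rw [hu, hv, ih n (Nat.lt_succ_self n)]
      cases n with
      | zero => simp [hb]
      | succ n => rw [ih (n + 1 - 1) (by omega)]

theorem alSalamCarlitzII_eq_ascPoly {q s p : ℝ} {α β : ℂ} (hq : q ≠ 0)
    (hq1 : ∀ n : ℕ, 1 ≤ n → q ^ n ≠ 1) (hα : α ≠ 0) (hβ : β ≠ 0) (hs : α + β = s)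
    (hp : α * β = p) (n : ℕ) (x : ℝ) :
    β ^ n * (q : ℂ) ^ n.choose 2 * alSalamCarlitzII (α / β) n ((x : ℂ) / β) (q : ℂ) =
      (((ascPoly q s p n).eval x : ℝ) : ℂ) := by
  rw [alSalamCarlitzII_eq_sum _ (by exact_mod_cast hq) hα hβ]
  refine eq_of_recurrence (u := fun n => alSalamCarlitzSum q α β x n)
    (v := fun n => (((ascPoly q s p n).eval x : ℝ) : ℂ))
    (a := fun n => (q : ℂ) ^ n * x - (α + β)) (b := fun n => α * β * (1 - (q : ℂ) ^ n))
    (by simp) ?_ ?_ ?_ n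
  · simp [alSalamCarlitzSum_zero, ascPoly]
  · intro n
    exact alSalamCarlitzSum_succ β x (by exact_mod_cast hq)
      (fun n hn => by exact_mod_cast hq1 n hn) hα n
  · intro n
    simp [ascPoly_succ, hs, hp]

/-! ### The lowering relation of `q`-Appell sets of type II -/

/-- The relation `Q_n(x) - Q_n(q x) = (1 - q^n) x Q_{n-1}(q x)`. -/
def IsQLowering (q : ℝ) (Q : ℕ → ℝ[X]) : Prop :=
  ∀ (n : ℕ) (x : ℝ), (Q n).eval x - (Q n).eval (q * x) =
    (1 - q ^ n) * x * (Q (n - 1)).eval (q * x)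

theorem isQAppellII_iff {q : ℝ} (hq1 : q ≠ 1) {Q : ℕ → ℝ[X]} (hQ : IsPolynomialSet Q) :
    IsQAppellII q Q ↔ IsQLowering q Q := by
  have h1 : 1 - q ≠ 0 := sub_ne_zero.2 hq1.symm
  constructor
  · rintro ⟨-, h⟩ n x
    rcases eq_or_ne x 0 with rfl | hx
    · simp
    · have := h n x hx
      rw [qDeriv, qNumber] at this
      field_simp at this
      linear_combination this
  · refine fun h => ⟨hQ, fun n x hx => ?_⟩
    rw [qDeriv, qNumber, h n x]
    field_simp

/-- Differencing the recurrence between x and qx works because q^{n+1} x = q^n (qx): the lowered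
terms reassemble into the previous recurrence evaluated at qx. -/
theorem isQLowering_ascPoly (q s p : ℝ) : IsQLowering q (ascPoly q s p) := by
  intro n
  induction n using Nat.strong_induction_on with
  | _ n ih =>
    intro x
    rcases n with _ | _ | n
    · simp [ascPoly]
    · simp [ascPoly]
      ring
    · have h1 := ih (n + 1) (by omega) x
      have h0 := ih n (by omega) x
      have e2 := fun y => congrArg (eval y) (ascPoly_succ q s p (n + 1))
      have e1 := fun y => congrArg (eval y) (ascPoly_succ q s p n)
      simp only [eval_sub, eval_mul, eval_C, eval_X, Nat.add_sub_cancel] at e1 e2 h1 ⊢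
      linear_combination e2 x - e2 (q * x) + (q ^ (n + 1) * x - s) * h1 -
        p * (1 - q ^ (n + 1)) * h0 - x * (1 - q ^ (n + 1)) * e1 (q * x)

theorem IsQLowering.add_lower {q c : ℝ} {A Q : ℕ → ℝ[X]} (hA : IsQLowering q A)
    (hQ : ∀ n, Q n = A n + C (c * (1 - q ^ n)) * A (n - 1)) : IsQLowering q Q := by
  intro n x
  rw [hQ n, hQ (n - 1)]
  cases n with
  | zero =>
    have := hA 0 x
    simp at this ⊢
    exact this
  | succ n =>
    have h1 := hA (n + 1) x
    have h0 := hA n x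
    simp only [eval_add, eval_mul, eval_C, Nat.add_sub_cancel] at h1 ⊢
    linear_combination h1 + c * (1 - q ^ (n + 1)) * h0

/-! ### Positive functionals and orthogonality -/

theorem map_mul_eq_zero_of_degree_lt {L : ℝ[X] →ₗ[ℝ] ℝ} {g : ℝ[X]} {n : ℕ}
    (h : ∀ m < n, L (X ^ m * g) = 0) {f : ℝ[X]} (hf : f.degree < n) : L (f * g) = 0 := by
  rcases eq_or_ne f 0 with rfl | hf0
  · simp
  rw [f.as_sum_range_C_mul_X_pow' ((natDegree_lt_iff_degree_lt hf0).2 hf), Finset.sum_mul, map_sum]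
  refine Finset.sum_eq_zero fun i hi => ?_
  rw [mul_assoc, ← smul_eq_C_mul, map_smul, h i (Finset.mem_range.1 hi), smul_zero]

theorem map_C_mul (L : ℝ[X] →ₗ[ℝ] ℝ) (c : ℝ) (f : ℝ[X]) : L (C c * f) = c * L f := by
  rw [← smul_eq_C_mul, map_smul, smul_eq_mul]

/-- Division by a polynomial of exact degree `n` with constant quotient. -/
theorem exists_degree_sub_C_mul_lt {f g : ℝ[X]} {n : ℕ} (hg : g.degree = n)
    (hf : f.degree < (n + 1 : ℕ)) :
    ∃ c : ℝ, (f - C c * g).degree < n := by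
  have hgn : g.coeff n ≠ 0 := coeff_ne_zero_of_eq_degree hg
  refine ⟨f.coeff n / g.coeff n, (degree_lt_iff_coeff_zero _ _).2 fun m hm => ?_⟩
  rw [coeff_sub, coeff_C_mul]
  rcases hm.eq_or_lt with rfl | hlt
  · rw [div_mul_cancel₀ _ hgn, sub_self]
  · rw [(degree_lt_iff_coeff_zero _ _).1 hf m hlt,
      coeff_eq_zero_of_degree_lt (hg ▸ Nat.cast_lt.2 hlt : g.degree < m)]
    simp

/-- A functional with an orthogonal polynomial set of positive square norms is positive. -/
theorem map_mul_self_nonneg_of_orthogonal {L : ℝ[X] →ₗ[ℝ] ℝ} {A : ℕ → ℝ[X]}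
    (hA : IsPolynomialSet A) (h0 : ∀ m n, m < n → L (X ^ m * A n) = 0)
    (h1 : ∀ n, 0 < L (A n * A n)) (f : ℝ[X]) : 0 ≤ L (f * f) := by
  have key : ∀ n : ℕ, ∀ f : ℝ[X], f.degree < n → 0 ≤ L (f * f) := by
    intro n
    induction n with
    | zero =>
      intro f hf
      have : f = 0 := by
        simpa [Nat.cast_zero, degree_lt_iff_coeff_zero, Polynomial.ext_iff] using hf
      simp [this]
    | succ n ih =>
      intro f hf
      obtain ⟨c, hc⟩ := exists_degree_sub_C_mul_lt (hA n) hf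
      have hz := map_mul_eq_zero_of_degree_lt (fun m hm => h0 m n hm) hc
      have e : f * f = (f - C c * A n) * (f - C c * A n) + C (2 * c) * ((f - C c * A n) * A n) +
          C (c * c) * (A n * A n) := by
        simp only [C_mul, show (C (2 : ℝ)) = 2 from rfl]
        ring
      rw [e, map_add, map_add, map_C_mul, map_C_mul, hz]
      have := ih _ hc
      have := mul_nonneg (mul_self_nonneg c) (h1 n).le
      linarith
  exact key (f.natDegree + 1) f (lt_of_le_of_lt degree_le_natDegree (by exact_mod_cast Nat.lt_succ_self _))

theorem isPolynomialSet_ascPoly {q : ℝ} (hq : q ≠ 0) (s p : ℝ) :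
    IsPolynomialSet (ascPoly q s p) := by
  intro n
  induction n using Nat.strong_induction_on with
  | _ n ih =>
    cases n with
    | zero => simp [ascPoly]
    | succ n =>
      have hd : ((C (q ^ n) * X - C s) * ascPoly q s p n).degree = ((n + 1 : ℕ) : WithBot ℕ) := by
        rw [degree_mul, ih n (by omega), sub_eq_add_neg, ← C_neg,
          degree_linear (pow_ne_zero _ hq)]
        push_cast
        exact add_comm _ _
      rw [ascPoly_succ, degree_sub_eq_left_of_degree_lt, hd]
      rw [hd]
      refine lt_of_le_of_lt ((degree_mul_le _ _).trans (add_le_add degree_C_le le_rfl)) ?_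
      rw [zero_add, ih (n - 1) (by omega)]
      exact_mod_cast (by omega : n - 1 < n + 1)

/-- The positive functional for which the polynomials `ascPoly` are orthogonal. -/
theorem exists_functional_ascPoly {q s p : ℝ} (hq : q ≠ 0)
    (hpos : ∀ n : ℕ, 1 ≤ n → 0 < q * (1 - q ^ n) * p) :
    ∃ L : ℝ[X] →ₗ[ℝ] ℝ, L 1 = 1 ∧ (∀ f, 0 ≤ L (f * f)) ∧
      (∀ m n, m < n → L (X ^ m * ascPoly q s p n) = 0) ∧
      ∀ n, L (X ^ n * ascPoly q s p n) ≠ 0 := by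
  have hA := isPolynomialSet_ascPoly hq s p
  let S : Polynomial.Sequence ℝ := ⟨ascPoly q s p, hA⟩
  have hS : ∀ i, IsUnit (S i).leadingCoeff := fun i =>
    (leadingCoeff_ne_zero.2 (S.ne_zero i)).isUnit
  -- The zeroth coordinate in the basis of the A_n is the only candidate: orthogonality to 1 forces
  -- L to kill A_n for n ≥ 1.
  let L : ℝ[X] →ₗ[ℝ] ℝ := (S.basis hS).coord 0
  have hL : ∀ n, L (ascPoly q s p n) = if n = 0 then 1 else 0 := fun n => by
    have : ascPoly q s p n = S.basis hS n := (S.basis_eq_self hS n).symm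
    rw [this, Module.Basis.coord_apply, Module.Basis.repr_self, Finsupp.single_apply]
  have hX : ∀ n (f : ℝ[X]), q ^ n * L (X * f * ascPoly q s p n) =
      L (f * ascPoly q s p (n + 1)) + s * L (f * ascPoly q s p n) +
        p * (1 - q ^ n) * L (f * ascPoly q s p (n - 1)) := fun n f => by
    rw [← map_C_mul, ← map_C_mul, ← map_C_mul, ← map_add, ← map_add, ascPoly_succ]
    congr 1
    ring
  have h0 : ∀ m n, m < n → L (X ^ m * ascPoly q s p n) = 0 := by
    intro m
    induction m with
    | zero =>
      intro n hn
      rw [pow_zero, one_mul, hL, if_neg hn.ne']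
    | succ m ih =>
      intro n hn
      have := hX n (X ^ m)
      rw [ih (n + 1) (by omega), ih n (by omega), ih (n - 1) (by omega), ← pow_succ'] at this
      simpa [hq] using this
  have hg : ∀ n : ℕ, 0 < p * (1 - q ^ (n + 1)) * q := fun n => by
    have := hpos (n + 1) (by omega)
    linarith
  have h1 : ∀ n, L (X ^ n * ascPoly q s p n) ≠ 0 := by
    intro n
    induction n with
    | zero => simp [hL]
    | succ n ih =>
      intro h
      have := hX (n + 1) (X ^ n)
      rw [h0 n (n + 1 + 1) (by omega), h0 n (n + 1) (by omega), ← pow_succ', h,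
        Nat.add_sub_cancel] at this
      have hne : p * (1 - q ^ (n + 1)) ≠ 0 := left_ne_zero_of_mul (hg n).ne'
      simp [ih] at this
      exact hne (by simpa using this)
  have hlow : ∀ m n, m < n → L (ascPoly q s p m * ascPoly q s p n) = 0 := fun m n hmn =>
    map_mul_eq_zero_of_degree_lt (fun k hk => h0 k n hk) (by rw [hA m]; exact_mod_cast hmn)
  have h2 : ∀ n, 0 < L (ascPoly q s p n * ascPoly q s p n) := by
    intro n
    induction n with
    | zero =>
      have h : ascPoly q s p 0 * ascPoly q s p 0 = ascPoly q s p 0 := by simp [ascPoly]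
      rw [h, hL]
      simp
    | succ n ih =>
      have e1 := hX (n + 1) (ascPoly q s p n)
      have e2 := hX n (ascPoly q s p (n + 1))
      have c : ∀ f g : ℝ[X], L (f * g) = L (g * f) := fun f g => by rw [mul_comm]
      rw [hlow n (n + 1 + 1) (by omega), hlow n (n + 1) (by omega), Nat.add_sub_cancel] at e1
      rw [c _ (ascPoly q s p n), mul_left_comm, ← mul_assoc, c _ (ascPoly q s p n),
        hlow n (n + 1) (by omega), c _ (ascPoly q s p (n - 1)),
        hlow (n - 1) (n + 1) (by omega)] at e2
      -- Both pairings contain L(x A_n A_{n+1}); eliminating it gives the ratio of consecutive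
      -- norms, positive by hypothesis.
      have e3 : L (ascPoly q s p (n + 1) * ascPoly q s p (n + 1)) * q ^ 2 =
          p * (1 - q ^ (n + 1)) * q * L (ascPoly q s p n * ascPoly q s p n) := by
        linear_combination q * e1 - q ^ 2 * e2
      have h3 := mul_pos (hg n) ih
      rw [← e3] at h3
      exact pos_of_mul_pos_left h3 (sq_nonneg q)
  refine ⟨L, ?_, map_mul_self_nonneg_of_orthogonal hA h0 h2, h0, h1⟩
  have := hL 0
  simpa [ascPoly] using this

/-! ### The Hamburger moment problem -/

/-- A nonnegative nonconstant real polynomial is a constant plus a square times a nonnegative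
polynomial of smaller degree. -/
theorem exists_eq_C_add_sq_mul {f : ℝ[X]} (hf : ∀ x, 0 ≤ f.eval x) (hd : 0 < f.degree) :
    ∃ (m c : ℝ) (r : ℝ[X]), 0 ≤ m ∧ f = C m + (X - C c) * (X - C c) * r ∧
      (∀ x, 0 ≤ r.eval x) ∧ r.natDegree < f.natDegree := by
  have ht : Filter.Tendsto (fun x : ℝ => f.eval x) (Filter.cocompact ℝ) Filter.atTop := by
    have := f.tendsto_norm_atTop hd tendsto_norm_cocompact_atTop
    refine this.congr fun x => ?_
    rw [Real.norm_of_nonneg (hf x)]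
  obtain ⟨c, hc⟩ := f.continuous.exists_forall_le ht
  -- After subtracting the minimum value, the minimiser c is a root at which the derivative vanishes
  -- too, hence a double root.
  set g : ℝ[X] := f - C (f.eval c) with hg
  have hg0 : ∀ x, 0 ≤ g.eval x := fun x => by simpa [hg] using hc x
  have hgc : g.IsRoot c := by simp [hg]
  obtain ⟨h, hh⟩ := dvd_iff_isRoot.2 hgc
  have hmin : IsLocalMin (fun x => g.eval x) c :=
    Filter.Eventually.of_forall fun x => by
      have := hg0 x
      rwa [← hgc.eq_zero] at this
  have hder := hmin.deriv_eq_zero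
  rw [Polynomial.deriv, hh] at hder
  have hhc : h.IsRoot c := by simpa [derivative_mul] using hder
  obtain ⟨r, hr⟩ := dvd_iff_isRoot.2 hhc
  have hfr : f = C (f.eval c) + (X - C c) * (X - C c) * r := by
    rw [mul_assoc, ← hr, ← hh, hg]
    ring
  refine ⟨f.eval c, c, r, hf c, hfr, ?_, ?_⟩
  · have hne : ∀ x ∈ ({c}ᶜ : Set ℝ), 0 ≤ r.eval x := fun x hx => by
      have h1 := hg0 x
      rw [hh, hr] at h1
      simp only [eval_mul, eval_sub, eval_X, eval_C, ← mul_assoc] at h1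
      exact nonneg_of_mul_nonneg_right h1 (mul_self_pos.2 (sub_ne_zero.2 hx))
    have hcl : IsClosed {x : ℝ | 0 ≤ r.eval x} := isClosed_le continuous_const r.continuous
    have hdense : Dense ({c}ᶜ : Set ℝ) := dense_compl_singleton c
    intro x
    exact hcl.closure_subset_iff.2 hne (hdense x)
  · rcases eq_or_ne r 0 with rfl | hr0
    · rw [natDegree_zero]
      exact natDegree_pos_iff_degree_pos.2 hd
    · have h1 : ((X - C c) * (X - C c) * r).natDegree = 2 + r.natDegree := by
        rw [natDegree_mul (mul_ne_zero (X_sub_C_ne_zero c) (X_sub_C_ne_zero c)) hr0,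
          natDegree_mul (X_sub_C_ne_zero c) (X_sub_C_ne_zero c), natDegree_X_sub_C]
      have h2 : f.natDegree = 2 + r.natDegree := by
        conv_lhs => rw [hfr]
        rw [natDegree_C_add, h1]
      omega

/-- No sum-of-squares decomposition is needed: after writing f = m + (X - c)² r, the induction
passes to the functional g ↦ L((X - c)² g), which is again nonnegative on squares. This is why L is
generalised. -/
theorem map_nonneg_of_eval_nonneg {L : ℝ[X] →ₗ[ℝ] ℝ} (hL : ∀ f, 0 ≤ L (f * f)) {f : ℝ[X]}
    (hf : ∀ x, 0 ≤ f.eval x) : 0 ≤ L f := by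
  induction hn : f.natDegree using Nat.strong_induction_on generalizing L f with
  | _ n ih =>
    have hC : ∀ m : ℝ, 0 ≤ m → 0 ≤ L (C m) := fun m hm => by
      rw [← mul_one (C m), map_C_mul]
      have := hL 1
      rw [one_mul] at this
      exact mul_nonneg hm this
    rcases le_or_gt f.degree 0 with hd | hd
    · rw [eq_C_of_degree_le_zero hd]
      refine hC _ ?_
      have := hf 0
      rwa [← coeff_zero_eq_eval_zero] at this
    · obtain ⟨m, c, r, hm, hfr, hr, hlt⟩ := exists_eq_C_add_sq_mul hf hd
      have := ih r.natDegree (hn ▸ hlt)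
        (L := L.comp (LinearMap.mulLeft ℝ ((X - C c) * (X - C c)))) (fun g => by
          have := hL ((X - C c) * g)
          rwa [mul_mul_mul_comm] at this) hr rfl
      rw [hfr, map_add]
      exact add_nonneg (hC m hm) this

/-- The real functions dominated by a polynomial. -/
def polynomiallyBounded : Submodule ℝ (ℝ → ℝ) where
  carrier := {f | ∃ p : ℝ[X], ∀ x, |f x| ≤ p.eval x}
  zero_mem' := ⟨0, by simp⟩
  add_mem' := by
    rintro f g ⟨p, hp⟩ ⟨r, hr⟩
    exact ⟨p + r, fun x => by
      rw [eval_add]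
      exact (abs_add_le _ _).trans (add_le_add (hp x) (hr x))⟩
  smul_mem' := by
    rintro c f ⟨p, hp⟩
    refine ⟨C |c| * p, fun x => ?_⟩
    rw [eval_mul, eval_C, Pi.smul_apply, smul_eq_mul, abs_mul]
    exact mul_le_mul_of_nonneg_left (hp x) (abs_nonneg c)

theorem abs_le_sq_add_one (t : ℝ) : |t| ≤ t * t + 1 := by
  rw [abs_le]
  constructor <;> nlinarith [sq_nonneg (t - 1), sq_nonneg (t + 1)]

/-- A polynomial as a polynomially bounded function. -/
noncomputable def polynomialFunction : ℝ[X] →ₗ[ℝ] polynomiallyBounded where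
  toFun p := ⟨fun x => p.eval x, p * p + 1, fun x => by
    simpa using abs_le_sq_add_one (p.eval x)⟩
  map_add' p r := by
    ext x
    simp
  map_smul' c p := by
    ext x
    simp

/-- A functional on polynomials that is nonnegative on nonnegative polynomials extends to a positive
functional on the polynomially bounded functions. -/
theorem exists_positive_extension {L : ℝ[X] →ₗ[ℝ] ℝ}
    (hL : ∀ f : ℝ[X], (∀ x, 0 ≤ f.eval x) → 0 ≤ L f) :
    ∃ g : polynomiallyBounded →ₗ[ℝ] ℝ, (∀ p, g (polynomialFunction p) = L p) ∧
      ∀ f : polynomiallyBounded, (∀ x, 0 ≤ f.1 x) → 0 ≤ g f := by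
  have hinj : Function.Injective polynomialFunction := fun p r h =>
    Polynomial.funext fun x => congrFun (congrArg Subtype.val h) x
  let e := LinearEquiv.ofInjective polynomialFunction hinj
  let F : polynomiallyBounded →ₗ.[ℝ] ℝ :=
    ⟨LinearMap.range polynomialFunction, L.comp e.symm.toLinearMap⟩
  let s : PointedCone ℝ polynomiallyBounded :=
    { carrier := {f | ∀ x, 0 ≤ f.1 x}
      zero_mem' := fun x => le_rfl
      add_mem' := fun hf hg x => add_nonneg (hf x) (hg x)
      smul_mem' := fun c f hf x => mul_nonneg c.2 (hf x) }
  have hF : ∀ p (h : polynomialFunction p ∈ F.domain), F ⟨polynomialFunction p, h⟩ = L p := by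
    intro p h
    change L (e.symm ⟨polynomialFunction p, h⟩) = L p
    congr 1
    exact e.symm_apply_apply p
  obtain ⟨g, hg, hpos⟩ := riesz_extension s F
    (by
      rintro ⟨_, p, rfl⟩ hp
      exact (hL p hp).trans_eq (hF p _).symm)
    (by
      -- Cofinality for M. Riesz's extension theorem: a polynomial dominating |f| moves f into the
      -- cone.
      rintro ⟨f, p, hp⟩
      refine ⟨⟨polynomialFunction p, p, rfl⟩, fun x => ?_⟩
      have := (abs_le.1 (hp x)).1
      change 0 ≤ p.eval x + f x
      linarith)
  exact ⟨g, fun p => (hg ⟨polynomialFunction p, p, rfl⟩).trans (hF p _), fun f hf => hpos f hf⟩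

/-- The continuous cutoff function equal to one on `[-n, n]`, with support in `[-n-1, n+1]`. -/
noncomputable def cutoff (n : ℕ) (x : ℝ) : ℝ := max 0 (min 1 (n + 1 - |x|))

theorem cutoff_nonneg (n : ℕ) (x : ℝ) : 0 ≤ cutoff n x := le_max_left _ _

theorem cutoff_le_one (n : ℕ) (x : ℝ) : cutoff n x ≤ 1 :=
  max_le zero_le_one (min_le_left _ _)

theorem cutoff_eq_one {n : ℕ} {x : ℝ} (h : |x| ≤ n) : cutoff n x = 1 := by
  rw [cutoff, min_eq_left (by linarith), max_eq_right zero_le_one]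

theorem continuous_cutoff (n : ℕ) : Continuous (cutoff n) := by
  unfold cutoff
  fun_prop

theorem hasCompactSupport_cutoff (n : ℕ) : HasCompactSupport (cutoff n) := by
  refine HasCompactSupport.intro (isCompact_closedBall (0 : ℝ) (n + 1)) fun x hx => ?_
  rw [mem_closedBall_zero_iff, Real.norm_eq_abs, not_le] at hx
  exact max_eq_left ((min_le_right _ _).trans (by linarith))

open scoped CompactlySupported in
/-- A compactly supported continuous function as a polynomially bounded function. -/
noncomputable def compactlySupportedFunction : C_c(ℝ, ℝ) →ₗ[ℝ] polynomiallyBounded where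
  toFun f := ⟨f, by
    obtain ⟨c, hc⟩ := f.hasCompactSupport.exists_bound_of_continuous f.continuous
    exact ⟨C c, fun x => by simpa using hc x⟩⟩
  map_add' f g := by
    ext x
    simp
  map_smul' c f := by
    ext x
    simp

open scoped CompactlySupported in
/-- The product of a polynomial and a cutoff function. -/
noncomputable def cutoffPolynomial (p : ℝ[X]) (n : ℕ) : C_c(ℝ, ℝ) where
  toFun x := p.eval x * cutoff n x
  continuous_toFun := p.continuous.mul (continuous_cutoff n)
  hasCompactSupport' := (hasCompactSupport_cutoff n).mul_left

theorem abs_map_le_of_positive {g : polynomiallyBounded →ₗ[ℝ] ℝ}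
    (hg : ∀ f : polynomiallyBounded, (∀ x, 0 ≤ f.1 x) → 0 ≤ g f) {f h : polynomiallyBounded}
    (hfh : ∀ x, |f.1 x| ≤ h.1 x) : |g f| ≤ g h := by
  have h1 := hg (h - f) fun x => sub_nonneg.2 (abs_le.1 (hfh x)).2
  have h2 := hg (h + f) fun x => by
    have := (abs_le.1 (hfh x)).1
    change 0 ≤ h.1 x + f.1 x
    linarith
  rw [map_sub] at h1
  rw [map_add] at h2
  rw [abs_le]
  constructor <;> linarith

/-- The tail bound that prevents mass escaping to infinity: beyond |x| = n, a factor n is paid for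
by raising the power, and the even exponent makes the bound a nonnegative polynomial, to which a
positive functional applies. -/
theorem abs_pow_mul_one_sub_cutoff_le (k : ℕ) {n : ℕ} (hn : 1 ≤ n) (x : ℝ) :
    |x ^ k - x ^ k * cutoff n x| ≤ (n : ℝ)⁻¹ * x ^ (2 * (k + 1)) := by
  have hn' : (1 : ℝ) ≤ n := by exact_mod_cast hn
  have he : 0 ≤ x ^ (2 * (k + 1)) := by
    rw [pow_mul']
    positivity
  rcases le_or_gt |x| n with h | h
  · rw [cutoff_eq_one h, mul_one, sub_self, abs_zero]
    positivity
  · have h1 : |x ^ k - x ^ k * cutoff n x| ≤ |x| ^ k := by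
      rw [← mul_one_sub, abs_mul, abs_pow]
      refine mul_le_of_le_one_right (by positivity) ?_
      rw [abs_le]
      constructor <;> linarith [cutoff_nonneg n x, cutoff_le_one n x]
    have h2 : |x| ^ (k + 1) ≤ |x| ^ (2 * (k + 1)) :=
      pow_le_pow_right₀ (by linarith) (by omega)
    have h3 : |x| ^ (2 * (k + 1)) = x ^ (2 * (k + 1)) := by
      rw [pow_mul, sq_abs, ← pow_mul]
    have h4 : |x| ^ k * n ≤ |x| ^ (k + 1) := by
      rw [pow_succ]
      exact mul_le_mul_of_nonneg_left h.le (by positivity)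
    rw [inv_mul_eq_div, le_div_iff₀ (by linarith)]
    calc _ ≤ |x| ^ k * n := mul_le_mul_of_nonneg_right h1 (by linarith)
      _ ≤ _ := h4.trans (h2.trans h3.le)

/-- The solution of the Hamburger moment problem: a functional on polynomials that is nonnegative on
squares is the integral with respect to a measure. -/
theorem exists_measure_of_map_mul_self_nonneg {L : ℝ[X] →ₗ[ℝ] ℝ} (hL : ∀ f, 0 ≤ L (f * f)) :
    ∃ μ : Measure ℝ, (∀ k : ℕ, Integrable (fun x : ℝ => x ^ k) μ) ∧
      ∀ k : ℕ, ∫ x, x ^ k ∂μ = L (X ^ k) := by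
  obtain ⟨g, hgL, hg⟩ := exists_positive_extension fun f hf => map_nonneg_of_eval_nonneg hL hf
  let Λ := PositiveLinearMap.mk₀ (g.comp compactlySupportedFunction)
    (fun f hf => hg _ fun x => CompactlySupportedContinuousMap.le_def.1 hf x)
  let μ := RealRMK.rieszMeasure Λ
  have hint : ∀ p n, ∫ x, p.eval x * cutoff n x ∂μ =
      g (compactlySupportedFunction (cutoffPolynomial p n)) :=
    fun p n => RealRMK.integral_rieszMeasure Λ (cutoffPolynomial p n)
  have hcc : ∀ (p : ℝ[X]) n, Integrable (fun x => p.eval x * cutoff n x) μ := fun p n =>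
    (p.continuous.mul (continuous_cutoff n)).integrable_of_hasCompactSupport
      ((hasCompactSupport_cutoff n).mul_left)
  -- Truncated integrals of a nonnegative p are at most L p, since the extended functional is
  -- monotone; integrability follows by exhaustion.
  have hsq : ∀ p : ℝ[X], (∀ x, 0 ≤ p.eval x) → Integrable (fun x => p.eval x) μ := by
    intro p hp
    have hcov : AECover μ Filter.atTop fun n : ℕ => Metric.closedBall (0 : ℝ) n :=
      aecover_closedBall tendsto_natCast_atTop_atTop
    refine hcov.integrable_of_integral_bounded_of_nonneg_ae (L p)
      (fun n => p.continuous.continuousOn.integrableOn_compact (isCompact_closedBall _ _))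
      (Filter.Eventually.of_forall hp) (Filter.Eventually.of_forall fun n => ?_)
    have h1 : ∫ x in Metric.closedBall (0 : ℝ) n, p.eval x ∂μ =
        ∫ x in Metric.closedBall (0 : ℝ) n, p.eval x * cutoff n x ∂μ := by
      refine setIntegral_congr_fun Metric.isClosed_closedBall.measurableSet fun x hx => ?_
      rw [mem_closedBall_zero_iff, Real.norm_eq_abs] at hx
      simp only [cutoff_eq_one hx, mul_one]
    rw [h1]
    refine (setIntegral_le_integral (hcc p n) (Filter.Eventually.of_forall fun x =>
      mul_nonneg (hp x) (cutoff_nonneg n x))).trans ?_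
    rw [hint, ← hgL]
    refine (le_abs_self _).trans (abs_map_le_of_positive hg fun x => ?_)
    change |p.eval x * cutoff n x| ≤ p.eval x
    rw [abs_of_nonneg (mul_nonneg (hp x) (cutoff_nonneg n x))]
    exact mul_le_of_le_one_right (hp x) (cutoff_le_one n x)
  have hI : ∀ k : ℕ, Integrable (fun x : ℝ => x ^ k) μ := by
    intro k
    refine (hsq (X ^ k * X ^ k + 1) fun x => ?_).mono' (by fun_prop)
      (Filter.Eventually.of_forall fun x => ?_)
    · simp only [eval_add, eval_mul, eval_pow, eval_X, eval_one]
      nlinarith [mul_self_nonneg (x ^ k)]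
    · simpa using abs_le_sq_add_one (x ^ k)
  refine ⟨μ, hI, fun k => ?_⟩
  have hlim1 : Filter.Tendsto (fun n : ℕ => ∫ x, x ^ k * cutoff n x ∂μ) Filter.atTop
      (nhds (∫ x, x ^ k ∂μ)) := by
    refine tendsto_integral_of_dominated_convergence (fun x => |x ^ k|) (fun n => ?_)
      (hI k).abs (fun n => Filter.Eventually.of_forall fun x => ?_)
      (Filter.Eventually.of_forall fun x => ?_)
    · exact ((continuous_pow k).mul (continuous_cutoff n)).aestronglyMeasurable
    · rw [norm_mul, Real.norm_eq_abs, Real.norm_of_nonneg (cutoff_nonneg n x)]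
      exact mul_le_of_le_one_right (abs_nonneg _) (cutoff_le_one n x)
    · refine tendsto_const_nhds.congr' ?_
      filter_upwards [Filter.eventually_ge_atTop ⌈|x|⌉₊] with n hn
      rw [cutoff_eq_one (Nat.ceil_le.1 hn), mul_one]
  have hlim2 : Filter.Tendsto (fun n : ℕ => ∫ x, x ^ k * cutoff n x ∂μ) Filter.atTop
      (nhds (L (X ^ k))) := by
    rw [tendsto_iff_norm_sub_tendsto_zero]
    have h0 : Filter.Tendsto (fun n : ℕ => (n : ℝ)⁻¹ * L (X ^ (2 * (k + 1)))) Filter.atTop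
        (nhds 0) := by
      simpa using (tendsto_inv_atTop_nhds_zero_nat (𝕜 := ℝ)).mul_const (L (X ^ (2 * (k + 1))))
    refine squeeze_zero' (Filter.Eventually.of_forall fun n => norm_nonneg _) ?_ h0
    filter_upwards [Filter.eventually_ge_atTop 1] with n hn
    have := hint (X ^ k) n
    simp only [eval_pow, eval_X] at this
    rw [this, norm_sub_rev, ← hgL, ← map_sub, ← map_C_mul, ← hgL]
    refine abs_map_le_of_positive hg fun x => ?_
    change |(X ^ k : ℝ[X]).eval x - (X ^ k : ℝ[X]).eval x * cutoff n x| ≤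
      (C (n : ℝ)⁻¹ * X ^ (2 * (k + 1)) : ℝ[X]).eval x
    simpa using abs_pow_mul_one_sub_cutoff_le k hn x
  exact tendsto_nhds_unique hlim1 hlim2

/-! ### Quasi-orthogonality through moment functionals -/

theorem integrable_eval {μ : Measure ℝ} (hμ : ∀ k : ℕ, Integrable (fun x : ℝ => x ^ k) μ)
    (f : ℝ[X]) : Integrable (fun x => f.eval x) μ := by
  induction f using Polynomial.induction_on' with
  | add p r hp hr =>
    simp only [eval_add]
    exact hp.add hr
  | monomial n a => simpa using (hμ n).const_mul a

/-- Integration of polynomials with respect to a measure with finite moments. -/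
noncomputable def momentFunctional (μ : Measure ℝ)
    (hμ : ∀ k : ℕ, Integrable (fun x : ℝ => x ^ k) μ) : ℝ[X] →ₗ[ℝ] ℝ where
  toFun f := ∫ x, f.eval x ∂μ
  map_add' f g := by
    simp only [eval_add]
    exact integral_add (integrable_eval hμ f) (integrable_eval hμ g)
  map_smul' c f := by
    simp only [eval_smul, smul_eq_mul, RingHom.id_apply]
    exact integral_const_mul c _

theorem integral_pow_mul_eval {μ : Measure ℝ} (hμ : ∀ k : ℕ, Integrable (fun x : ℝ => x ^ k) μ)
    (m : ℕ) (f : ℝ[X]) : ∫ x, x ^ m * f.eval x ∂μ = momentFunctional μ hμ (X ^ m * f) := by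
  simp [momentFunctional]

/-- Quasi-orthogonality in terms of a linear functional which is nonnegative on squares. -/
theorem isQuasiOrthogonal_of_functional {Q : ℕ → ℝ[X]} (hQ : IsPolynomialSet Q) (hQ0 : Q 0 = 1)
    {L : ℝ[X] →ₗ[ℝ] ℝ} (hL1 : L 1 = 1) (hL : ∀ f, 0 ≤ L (f * f))
    (h0 : ∀ m n : ℕ, m + 2 ≤ n → L (X ^ m * Q n) = 0)
    (h1 : ∀ m n : ℕ, m + 1 = n → L (X ^ m * Q n) ≠ 0) : IsQuasiOrthogonal Q := by
  obtain ⟨μ, hμ, hμL⟩ := exists_measure_of_map_mul_self_nonneg hL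
  -- The normalisation of L allows the distribution function of μ to serve as φ on the whole line.
  have hprob : IsProbabilityMeasure μ := by
    have h := hμL 0
    simp only [pow_zero, hL1, integral_const, smul_eq_mul, mul_one] at h
    refine ⟨?_⟩
    rwa [measureReal_def, ENNReal.toReal_eq_one_iff] at h
  have hφ := ProbabilityTheory.monotone_cdf μ
  have hdist : distributionOn ⊥ ⊤ (ProbabilityTheory.cdf μ) hφ = μ := by
    have hst : hφ.stieltjesFunction = ProbabilityTheory.cdf μ := by
      ext x
      rw [hφ.stieltjesFunction_eq, StieltjesFunction.rightLim_eq]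
    have hset : {x : ℝ | (⊥ : EReal) < (x : EReal) ∧ (x : EReal) < ⊤} = Set.univ := by
      ext x
      simp [EReal.bot_lt_coe, EReal.coe_lt_top]
    rw [distributionOn, hst, hset, Measure.restrict_univ, ProbabilityTheory.measure_cdf]
  have hLμ : momentFunctional μ hμ = L := by
    refine Polynomial.lhom_ext' fun k => LinearMap.ext_ring ?_
    have := hμL k
    simpa [momentFunctional, monomial_one_right_eq_X_pow] using this
  refine ⟨hQ, ⊥, ⊤, ProbabilityTheory.cdf μ, hφ, bot_lt_top, ?_⟩
  rw [hdist]
  refine ⟨hμ, fun m n hmn => ?_, fun m n hmn => ?_, ?_⟩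
  · rw [integral_pow_mul_eval hμ, hLμ]
    exact h0 m n hmn
  · rw [integral_pow_mul_eval hμ, hLμ]
    exact h1 m n hmn
  · simp [hQ0]

theorem IsQuasiOrthogonal.exists_functional {Q : ℕ → ℝ[X]} (h : IsQuasiOrthogonal Q) :
    ∃ L : ℝ[X] →ₗ[ℝ] ℝ, L (Q 0) ≠ 0 ∧ (∀ f, 0 ≤ L (f * f)) ∧
      (∀ m n : ℕ, m + 2 ≤ n → L (X ^ m * Q n) = 0) ∧
      ∀ m n : ℕ, m + 1 = n → L (X ^ m * Q n) ≠ 0 := by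
  obtain ⟨-, a, b, φ, hφ, -, hμ, h0, h1, h2⟩ := h
  refine ⟨momentFunctional _ hμ, h2, fun f => ?_, fun m n hmn => ?_, fun m n hmn => ?_⟩
  · refine integral_nonneg fun x => ?_
    simp only [eval_mul, Pi.zero_apply]
    exact mul_self_nonneg _
  · rw [← integral_pow_mul_eval]
    exact h0 m n hmn
  · rw [← integral_pow_mul_eval]
    exact h1 m n hmn

/-! ### Orthogonal polynomials from quasi-orthogonal ones -/

theorem map_mul_eq_zero_of_map_mul_self_eq_zero {L : ℝ[X] →ₗ[ℝ] ℝ} (hL : ∀ f, 0 ≤ L (f * f))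
    {f : ℝ[X]} (hf : L (f * f) = 0) (g : ℝ[X]) : L (f * g) = 0 := by
  by_contra hne
  have h : ∀ t : ℝ, 0 ≤ L (g * g) - 2 * t * L (f * g) := fun t => by
    have := hL (g - C t * f)
    have e : (g - C t * f) * (g - C t * f) = g * g - C (2 * t) * (f * g) + C (t * t) * (f * f) := by
      simp only [C_mul, show (C (2 : ℝ)) = 2 from rfl]
      ring
    rwa [e, map_add, map_sub, map_C_mul, map_C_mul, hf, mul_zero, add_zero] at this
  -- This t makes the quantity equal to -1.
  have := h ((L (g * g) + 1) / (2 * L (f * g)))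
  field_simp at this
  linarith

/-- The orthogonal polynomials behind a quasi-orthogonal polynomial set. -/
noncomputable def orthogonalPart (L : ℝ[X] →ₗ[ℝ] ℝ) (Q : ℕ → ℝ[X]) : ℕ → ℝ[X]
  | 0 => Q 0
  | n + 1 => Q (n + 1) -
      C (L (X ^ n * Q (n + 1)) / L (X ^ n * orthogonalPart L Q n)) * orthogonalPart L Q n

theorem isPolynomialSet_orthogonalPart (L : ℝ[X] →ₗ[ℝ] ℝ) {Q : ℕ → ℝ[X]}
    (hQ : IsPolynomialSet Q) : IsPolynomialSet (orthogonalPart L Q) := by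
  intro n
  induction n with
  | zero => exact hQ 0
  | succ n ih =>
    rw [orthogonalPart, degree_sub_eq_left_of_degree_lt, hQ]
    refine lt_of_le_of_lt ((degree_mul_le _ _).trans (add_le_add degree_C_le le_rfl)) ?_
    rw [zero_add, ih, hQ]
    exact_mod_cast Nat.lt_succ_self n

/-- L is only known to be nonnegative on squares, yet the nonvanishing pairings make it definite: if
L(P_n²) = 0, Cauchy-Schwarz gives L(P_n Q_{n+1}) = 0. As X^n is a multiple of P_n plus lower terms,
which Q_{n+1} annihilates, L(X^n Q_{n+1}) would vanish. -/
theorem exists_orthogonal_of_quasiOrthogonal {L : ℝ[X] →ₗ[ℝ] ℝ} (hL : ∀ f, 0 ≤ L (f * f))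
    {Q : ℕ → ℝ[X]} (hQ : IsPolynomialSet Q)
    (h0 : ∀ m n : ℕ, m + 2 ≤ n → L (X ^ m * Q n) = 0)
    (h1 : ∀ m n : ℕ, m + 1 = n → L (X ^ m * Q n) ≠ 0) :
    ∃ (P : ℕ → ℝ[X]) (e : ℕ → ℝ), IsPolynomialSet P ∧ P 0 = Q 0 ∧ e 0 = 0 ∧
      (∀ n, Q n = P n + C (e n) * P (n - 1)) ∧ (∀ n, e (n + 1) ≠ 0) ∧
      (∀ (n : ℕ) (f : ℝ[X]), f.degree < n → L (f * P n) = 0) ∧ ∀ n, 0 < L (P n * P n) := by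
  set P := orthogonalPart L Q with hP
  have hdeg := isPolynomialSet_orthogonalPart L hQ
  have hpos : ∀ n, (∀ m < n, L (X ^ m * P n) = 0) → 0 < L (P n * P n) := by
    intro n hn
    refine lt_of_le_of_ne (hL _) fun hz => ?_
    obtain ⟨c, hc⟩ := exists_degree_sub_C_mul_lt (f := X ^ n) (hdeg n)
      (by rw [degree_X_pow]; exact_mod_cast Nat.lt_succ_self n)
    have e1 := map_mul_eq_zero_of_degree_lt (L := L) (g := Q (n + 1))
      (fun m hm => h0 m (n + 1) (by omega)) hc
    have e2 := map_mul_eq_zero_of_map_mul_self_eq_zero hL hz.symm (Q (n + 1))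
    rw [sub_mul, map_sub, mul_assoc, map_C_mul, e2, mul_zero, sub_zero] at e1
    exact h1 n (n + 1) rfl e1
  have hne : ∀ n, (∀ m < n, L (X ^ m * P n) = 0) → L (X ^ n * P n) ≠ 0 := by
    intro n hn hz
    refine (hpos n hn).ne' (map_mul_eq_zero_of_degree_lt (n := n + 1) (fun m hm => ?_) ?_)
    · rcases (Nat.lt_succ_iff.1 hm).lt_or_eq with h | rfl
      · exact hn m h
      · exact hz
    · rw [hdeg]
      exact_mod_cast Nat.lt_succ_self n
  have horth : ∀ n, ∀ m < n, L (X ^ m * P n) = 0 := by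
    intro n
    induction n with
    | zero => intro m hm; omega
    | succ n ih =>
      intro m hm
      rw [hP, orthogonalPart, ← hP, mul_sub, map_sub, mul_left_comm, map_C_mul]
      rcases (Nat.lt_succ_iff.1 hm).lt_or_eq with h | rfl
      · rw [ih m h, h0 m (n + 1) (by omega)]
        simp
      · rw [div_mul_cancel₀ _ (hne m ih), sub_self]
  refine ⟨P, fun n => Nat.casesOn n 0
    fun n => L (X ^ n * Q (n + 1)) / L (X ^ n * P n), hdeg, rfl, rfl, fun n => ?_, fun n => ?_,
    fun n f hf => map_mul_eq_zero_of_degree_lt (horth n) hf, fun n => hpos n (horth n)⟩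
  · cases n with
    | zero => simp [hP, orthogonalPart]
    | succ n =>
      rw [hP, orthogonalPart, ← hP]
      simp
  · exact div_ne_zero (h1 n (n + 1) rfl) (hne n (horth n))

/-! ### Expansions in lowering sequences -/

theorem eq_C_of_eval_eq_eval_mul {q : ℝ} (hq1 : ∀ n : ℕ, 1 ≤ n → q ^ n ≠ 1) {f : ℝ[X]}
    (hf : ∀ x, f.eval x = f.eval (q * x)) : f = C (f.eval 0) := by
  have h : f = f.comp (C q * X) := Polynomial.funext fun x => by simpa using hf x
  ext n
  rcases n with _ | n
  · rw [coeff_C_zero, coeff_zero_eq_eval_zero]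
  · rw [coeff_C_of_ne_zero (Nat.succ_ne_zero n)]
    have := congrArg (fun g => coeff g (n + 1)) h
    simp only [comp_C_mul_X_coeff] at this
    have h2 : f.coeff (n + 1) * (1 - q ^ (n + 1)) = 0 := by linear_combination this
    exact (mul_eq_zero.1 h2).resolve_right (one_sub_pow_ne_zero_of hq1 n)

/-- The product `(1 - q) (1 - q^2) ⋯ (1 - q^n)`. -/
noncomputable def qFactor (q : ℝ) (n : ℕ) : ℝ := ∏ j ∈ Finset.range n, (1 - q ^ (j + 1))

theorem qFactor_succ (q : ℝ) (n : ℕ) : qFactor q (n + 1) = qFactor q n * (1 - q ^ (n + 1)) :=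
  Finset.prod_range_succ _ _

theorem qFactor_ne_zero {q : ℝ} (hq1 : ∀ n : ℕ, 1 ≤ n → q ^ n ≠ 1) (n : ℕ) : qFactor q n ≠ 0 :=
  Finset.prod_ne_zero_iff.2 fun j _ => one_sub_pow_ne_zero_of hq1 j

/-- Two sequences with the lowering relation differ by a convolution with constants. -/
theorem IsQLowering.exists_expansion {q : ℝ} (hq1 : ∀ n : ℕ, 1 ≤ n → q ^ n ≠ 1) {Q W : ℕ → ℝ[X]}
    (hQ : IsQLowering q Q) (hQ0 : Q 0 = 1) (hW : IsQLowering q W) :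
    ∃ h : ℕ → ℝ, ∀ n, W n =
      ∑ i ∈ Finset.HasAntidiagonal.antidiagonal n, C (qFactor q n * h i.1 * (qFactor q i.2)⁻¹) * Q i.2 := by
  -- Values at 0, normalised by `qFactor`, turn the expansion into a product of power series; Q_0 =
  -- 1 makes A invertible, so h is the quotient B / A.
  let A : PowerSeries ℝ := PowerSeries.mk fun n => (qFactor q n)⁻¹ * (Q n).eval 0
  let B : PowerSeries ℝ := PowerSeries.mk fun n => (qFactor q n)⁻¹ * (W n).eval 0
  have hA : PowerSeries.constantCoeff A ≠ 0 := by
    simp [A, hQ0, qFactor]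
  refine ⟨fun n => PowerSeries.coeff n (B * A⁻¹), ?_⟩
  set h : ℕ → ℝ := fun n => PowerSeries.coeff n (B * A⁻¹) with hh
  have h0 : ∀ n, (qFactor q n)⁻¹ * (W n).eval 0 =
      ∑ i ∈ Finset.HasAntidiagonal.antidiagonal n, h i.1 * ((qFactor q i.2)⁻¹ * (Q i.2).eval 0) := by
    intro n
    have e : B * A⁻¹ * A = B := by rw [mul_assoc, PowerSeries.inv_mul_cancel A hA, mul_one]
    have := congrArg (PowerSeries.coeff n) e
    rw [PowerSeries.coeff_mul] at this
    simpa [A, B, hh] using this.symm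
  intro n
  have hF := qFactor_ne_zero hq1
  -- The difference D_n vanishes at 0 by the choice of h. If D_n = 0, the lowering relation gives
  -- D_{n+1}(x) = D_{n+1}(qx), so D_{n+1} is constant, hence 0.
  suffices hD : ∀ n, W n - ∑ i ∈ Finset.HasAntidiagonal.antidiagonal n,
      C (qFactor q n * h i.1 * (qFactor q i.2)⁻¹) * Q i.2 = 0 from sub_eq_zero.1 (hD n)
  have hzero : ∀ n, (W n - ∑ i ∈ Finset.HasAntidiagonal.antidiagonal n,
      C (qFactor q n * h i.1 * (qFactor q i.2)⁻¹) * Q i.2).eval 0 = 0 := by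
    intro n
    have e := h0 n
    rw [inv_mul_eq_iff_eq_mul₀ (hF n), Finset.mul_sum] at e
    rw [eval_sub, eval_finsetSum, e, sub_eq_zero]
    refine Finset.sum_congr rfl fun i _ => ?_
    rw [eval_mul, eval_C]
    ring
  intro n
  induction n with
  | zero =>
    rw [eq_C_of_eval_eq_eval_mul hq1 (f := _ - _) fun x => ?_, hzero, C_0]
    have := hW 0 x
    simp [hQ0] at this ⊢
    linarith
  | succ n ih =>
    rw [eq_C_of_eval_eq_eval_mul hq1 (f := _ - _) fun x => ?_, hzero, C_0]
    have hw := hW (n + 1) x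
    have hn := congrArg (eval (q * x)) ih
    rw [eval_zero, eval_sub, eval_finsetSum, sub_eq_zero] at hn
    rw [Nat.add_sub_cancel, hn] at hw
    simp only [eval_sub, eval_finsetSum, eval_mul, eval_C] at hw ⊢
    rw [sub_eq_sub_iff_sub_eq_sub, hw, ← Finset.sum_sub_distrib,
      Finset.Nat.sum_antidiagonal_succ', Finset.mul_sum]
    have e0 := hQ 0 x
    rw [pow_zero, sub_self, zero_mul, zero_mul] at e0
    rw [← mul_sub, e0, mul_zero, zero_add]
    refine Finset.sum_congr rfl fun i _ => ?_
    have e1 := hQ (i.2 + 1) x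
    rw [Nat.add_sub_cancel] at e1
    rw [← mul_sub, e1, qFactor_succ, qFactor_succ]
    have := hF i.2
    have := one_sub_pow_ne_zero_of hq1 i.2
    field_simp

/-- The weight q^n is what makes this work: it matches the term produced by the factor X, since
q^{n-1} (qx) = q^n x. Expanding this sequence in the Q_n gives their recurrence. -/
theorem IsQLowering.succ_sub {q : ℝ} {Q : ℕ → ℝ[X]} (hQ : IsQLowering q Q) :
    IsQLowering q fun n => Q (n + 1) - C (q ^ n) * X * Q n := by
  intro n x
  have h1 := hQ (n + 1) x
  have h0 := hQ n x
  simp only [eval_sub, eval_mul, eval_C, eval_X, Nat.add_sub_cancel] at h1 ⊢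
  cases n with
  | zero =>
    simp at h0 h1 ⊢
    linear_combination h1 - x * h0
  | succ n =>
    simp only [Nat.add_sub_cancel] at h0 ⊢
    linear_combination h1 - q ^ (n + 1) * x * h0

theorem IsQLowering.exists_recurrence {q : ℝ} (hq1 : ∀ n : ℕ, 1 ≤ n → q ^ n ≠ 1) {Q : ℕ → ℝ[X]}
    (hQ : IsQLowering q Q) (hQ0 : Q 0 = 1) :
    ∃ h : ℕ → ℝ, ∀ n, Q (n + 1) = C (q ^ n) * X * Q n +
      ∑ i ∈ Finset.HasAntidiagonal.antidiagonal n, C (qFactor q n * h i.1 * (qFactor q i.2)⁻¹) * Q i.2 := by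
  obtain ⟨h, hh⟩ := hQ.exists_expansion hq1 hQ0 hQ.succ_sub
  exact ⟨h, fun n => by rw [← hh n]; ring⟩

theorem eq_ascPoly_of_recurrence {q : ℝ} (hq1 : ∀ n : ℕ, 1 ≤ n → q ^ n ≠ 1) {Q : ℕ → ℝ[X]}
    (hQ0 : Q 0 = 1) {h : ℕ → ℝ} (hQ : ∀ n, Q (n + 1) = C (q ^ n) * X * Q n +
      ∑ i ∈ Finset.HasAntidiagonal.antidiagonal n, C (qFactor q n * h i.1 * (qFactor q i.2)⁻¹) * Q i.2)
    (hh : ∀ k, h (k + 2) = 0) (n : ℕ) : Q n = ascPoly q (-h 0) (-h 1) n := by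
  refine eq_of_recurrence (a := fun n => C (q ^ n) * X - C (-h 0))
    (b := fun n => C (-h 1 * (1 - q ^ n))) (by simp) (by rw [hQ0, ascPoly]) (fun n => ?_)
    (ascPoly_succ q _ _) n
  have hF := qFactor_ne_zero hq1
  rw [hQ]
  rcases n with _ | n
  · simp [qFactor]
    ring
  · have e1 : qFactor q (n + 1) * h 0 * (qFactor q (n + 1))⁻¹ = h 0 := by
      have := hF (n + 1)
      field_simp
    have e2 : qFactor q (n + 1) * h 1 * (qFactor q n)⁻¹ = h 1 * (1 - q ^ (n + 1)) := by
      have := hF n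
      rw [qFactor_succ]
      field_simp
    rw [Finset.Nat.sum_antidiagonal_succ]
    have e3 : ∑ i ∈ Finset.HasAntidiagonal.antidiagonal n,
        C (qFactor q (n + 1) * h (i.1 + 1) * (qFactor q i.2)⁻¹) * Q i.2 =
        C (qFactor q (n + 1) * h 1 * (qFactor q n)⁻¹) * Q n := by
      rw [Finset.sum_eq_single (0, n)]
      · rintro ⟨i, j⟩ hij hne
        rcases i with _ | i
        · exact absurd (by simpa using hij) (fun hj : j = n => hne (by rw [hj]))
        · simp [hh]
      · simp
    rw [e3]
    simp only [e1, e2, Nat.add_sub_cancel, C_neg, neg_mul]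
    ring

/-- Comparison of the coefficients of orthogonal polynomials in the recurrence of a lowering
sequence. -/
theorem recurrence_coeff_relation {q : ℝ} (hq1 : ∀ n : ℕ, 1 ≤ n → q ^ n ≠ 1)
    {L : ℝ[X] →ₗ[ℝ] ℝ} {P Q : ℕ → ℝ[X]} {e : ℕ → ℝ} {h : ℕ → ℝ}
    (hP : IsPolynomialSet P) (horth : ∀ (n : ℕ) (f : ℝ[X]), f.degree < n → L (f * P n) = 0)
    (hpos : ∀ n, 0 < L (P n * P n)) (he0 : e 0 = 0) (hQP : ∀ n, Q n = P n + C (e n) * P (n - 1))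
    (hQ : ∀ n, Q (n + 1) = C (q ^ n) * X * Q n +
      ∑ i ∈ Finset.HasAntidiagonal.antidiagonal n, C (qFactor q n * h i.1 * (qFactor q i.2)⁻¹) * Q i.2)
    {j k : ℕ} (h1 : L (P j * Q (j + 1 + k + 1)) = 0) (h2 : L (X * P j * Q (j + 1 + k)) = 0) :
    h (k + 1) * (1 - q ^ (j + 1)) + h k * e (j + 1) = 0 := by
  have hF := qFactor_ne_zero hq1
  have horth' : ∀ m n, m < n → L (P m * P n) = 0 := fun m n hmn =>
    horth n _ (by rw [hP]; exact_mod_cast hmn)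
  have horth'' : ∀ m n, m < n → L (P n * P m) = 0 := fun m n hmn => by
    rw [mul_comm]; exact horth' m n hmn
  have hexp : ∀ m, L (P j * Q m) = L (P j * P m) + e m * L (P j * P (m - 1)) := fun m => by
    rw [hQP, mul_add, map_add, mul_left_comm, map_C_mul]
  have hlow : ∀ m < j, L (P j * Q m) = 0 := fun m hm => by
    rw [hexp, horth'' m j hm, horth'' (m - 1) j (by omega)]
    simp
  have hhigh : ∀ m, j + 1 < m → L (P j * Q m) = 0 := fun m hm => by
    rw [hexp, horth' j m (by omega), horth' j (m - 1) (by omega)]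
    simp
  rw [hQ, mul_add, map_add, show P j * (C (q ^ (j + 1 + k)) * X * Q (j + 1 + k)) =
    C (q ^ (j + 1 + k)) * (X * P j * Q (j + 1 + k)) by ring, map_C_mul, h2, mul_zero, zero_add,
    Finset.mul_sum, map_sum] at h1
  -- Since Q_b = P_b + e_b P_{b-1}, only b = j and b = j + 1 pair nontrivially with P_j.
  rw [Finset.sum_eq_add (k + 1, j) (k, j + 1) (by simp) (by
      rintro ⟨a, b⟩ hab ⟨hn1, hn2⟩
      rw [Finset.HasAntidiagonal.mem_antidiagonal] at hab
      simp only [ne_eq, Prod.mk.injEq, not_and] at hab hn1 hn2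
      rw [mul_left_comm, map_C_mul]
      rcases lt_or_ge b j with hb | hb
      · rw [hlow b hb, mul_zero]
      · rw [hhigh b (by omega), mul_zero])
    (fun hn => absurd (Finset.HasAntidiagonal.mem_antidiagonal.2 (by simp only; omega)) hn)
    (fun hn => absurd (Finset.HasAntidiagonal.mem_antidiagonal.2 (by simp only; omega)) hn),
    mul_left_comm, map_C_mul, mul_left_comm, map_C_mul] at h1
  have e1 : L (P j * Q j) = L (P j * P j) := by
    rw [hexp]
    rcases j with _ | j
    · rw [he0, zero_mul, add_zero]
    · rw [Nat.add_sub_cancel, horth'' j (j + 1) (by omega), mul_zero, add_zero]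
  have e2 : L (P j * Q (j + 1)) = e (j + 1) * L (P j * P j) := by
    rw [hexp, horth' _ _ (by omega), zero_add, Nat.add_sub_cancel]
  rw [e1, e2] at h1
  have hκ := (hpos j).ne'
  have hFj := hF j
  have hFn := hF (j + 1 + k)
  have hqj := one_sub_pow_ne_zero_of hq1 j
  simp only [qFactor_succ q j] at h1
  field_simp at h1
  rw [mul_zero] at h1
  exact (mul_eq_zero.1 h1).resolve_left (mul_ne_zero hFn hκ)

/-! ### Parameter shift of the Al-Salam-Carlitz II polynomials -/

/-- Replacing the parameter pair (a, b) by (qa, b) costs one extra lower term. Hence an A_n with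
real parameters has the form required in condition 2. -/
theorem ascPoly_shift (q a b : ℝ) (n : ℕ) :
    ascPoly q (q * a + b) (q * (a * b)) n = ascPoly q (a + b) (a * b) n +
      C (a * (1 - q ^ n)) * ascPoly q (a + b) (a * b) (n - 1) := by
  refine eq_of_recurrence (u := ascPoly q (q * a + b) (q * (a * b)))
    (v := fun n => ascPoly q (a + b) (a * b) n +
      C (a * (1 - q ^ n)) * ascPoly q (a + b) (a * b) (n - 1))
    (a := fun n => C (q ^ n) * X - C (q * a + b))
    (b := fun n => C (q * (a * b) * (1 - q ^ n))) (by simp) (by simp [ascPoly])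
    (ascPoly_succ q _ _) (fun n => ?_) n
  have e1 := ascPoly_succ q (a + b) (a * b) n
  rcases n with _ | n
  · simp [ascPoly]
    ring
  · have e0 := ascPoly_succ q (a + b) (a * b) n
    simp only [Nat.add_sub_cancel] at e1 ⊢
    simp only [C_mul, C_add, C_sub, C_1, C_pow] at e0 e1 ⊢
    linear_combination e1 + C q * C a * (1 - C q ^ (n + 1)) * e0

/-! ### A nonlinear recurrence of order one -/

/-- A positive sequence with `u_{n+1} = w_n - t_n / u_n`, where `w_n` tends to `1`, cannot have the
limit of `t_n` larger than `1 / 4`. -/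
theorem limit_le_of_positive_recurrence {u w t : ℕ → ℝ} {τ : ℝ} {N : ℕ} (hu : ∀ n ≥ N, 0 < u n)
    (hr : ∀ n, u (n + 1) + t n / u n = w n) (hw : Filter.Tendsto w Filter.atTop (nhds 1))
    (ht : Filter.Tendsto t Filter.atTop (nhds τ)) : 4 * τ ≤ 1 := by
  by_contra! hτ
  have hsqrt : 1 / 2 < √τ := Real.lt_sqrt_of_sq_lt (by linarith)
  obtain ⟨a, ha1, ha2⟩ := exists_between hsqrt
  have ha : a ^ 2 < τ := (Real.lt_sqrt (by linarith)).1 ha2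
  obtain ⟨d, hd1, hd2⟩ := exists_between (show (1 : ℝ) < 2 * a by linarith)
  have hev := (hw.eventually_lt_const hd1).and
    ((ht.eventually_const_lt ha).and (Filter.eventually_ge_atTop N))
  obtain ⟨M, hM⟩ := Filter.eventually_atTop.1 hev
  have hstep : ∀ n ≥ M, u (n + 1) ≤ u n - (2 * a - d) := by
    intro n hn
    obtain ⟨h1, h2, h3⟩ := hM n hn
    have hun := hu n h3
    -- The AM-GM inequality; since w_n < d < 2a eventually, u falls by a fixed amount at each step
    -- and becomes negative.
    have : 2 * a ≤ u n + t n / u n := by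
      rw [← sub_nonneg, show u n + t n / u n - 2 * a = ((u n - a) ^ 2 + (t n - a ^ 2)) / u n by
        field_simp; ring]
      exact div_nonneg (add_nonneg (sq_nonneg _) (by linarith)) hun.le
    linarith [hr n]
  have hlin : ∀ k : ℕ, u (M + k) ≤ u M - k * (2 * a - d) := by
    intro k
    induction k with
    | zero => simp
    | succ k ih =>
      have := hstep (M + k) (by omega)
      push_cast
      rw [← add_assoc]
      linarith
  obtain ⟨k, hk⟩ := exists_nat_gt (u M / (2 * a - d))
  rw [div_lt_iff₀ (by linarith)] at hk
  have := hu (M + k) ((hM (M + k) (by omega)).2.2)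
  linarith [hlin k]

/-- Write t_n = p (1 - q^{n+1}) and w_n = s - c q^n. Multiplying the recurrence by r_{n+1} shows
r_n² ≤ w_n r_n, so r_n and w_n share their sign and t_n w_{n+1} w_n > 0. The limit of this
inequality, rescaled when |q| > 1, determines the sign of p. -/
theorem sign_of_positive_recurrence {q s p c : ℝ} (hq0 : q ≠ 0) (hq1 : q ≠ 1) (hq2 : q ≠ -1)
    {r : ℕ → ℝ} (h0 : r 0 = s - c)
    (hr : ∀ n, r (n + 1) + p * (1 - q ^ (n + 1)) / r n = s - c * q ^ (n + 1))
    (hpos : ∀ n, 0 < p * (1 - q ^ (n + 1)) * r (n + 1) * r n) :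
    (∀ n, 0 < p * (1 - q ^ (n + 1))) ∧ 4 * p ≤ s ^ 2 := by
  have hr0 : ∀ n, r n ≠ 0 := fun n => right_ne_zero_of_mul (hpos n).ne'
  have hp0 : p ≠ 0 := fun h => by simpa [h] using hpos 0
  have hwr : ∀ n, r n ^ 2 ≤ (s - c * q ^ n) * r n := by
    intro n
    rcases n with _ | n
    · rw [h0, pow_zero, mul_one, sq]
    · rw [← hr n, add_mul, ← sq, le_add_iff_nonneg_right,
        show p * (1 - q ^ (n + 1)) / r n * r (n + 1) =
          p * (1 - q ^ (n + 1)) * r (n + 1) * r n / r n ^ 2 by field_simp]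
      exact div_nonneg (hpos n).le (sq_nonneg _)
  have hwr' : ∀ n, 0 < (s - c * q ^ n) * r n := fun n =>
    (sq_pos_of_ne_zero (hr0 n)).trans_le (hwr n)
  have htw : ∀ n, 0 < p * (1 - q ^ (n + 1)) * (s - c * q ^ (n + 1)) * (s - c * q ^ n) := by
    intro n
    have h1 := mul_pos (mul_pos (hpos n) (hwr' n)) (hwr' (n + 1))
    have h2 : 0 < (r (n + 1) * r n) ^ 2 := sq_pos_of_ne_zero (mul_ne_zero (hr0 _) (hr0 _))
    refine pos_of_mul_pos_left (b := (r (n + 1) * r n) ^ 2) ?_ h2.le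
    linarith
  rcases lt_or_gt_of_ne (show |q| ≠ 1 by
    intro h
    rcases eq_or_eq_neg_of_abs_eq h with h | h
    · exact hq1 h
    · exact hq2 h) with hq | hq
  · have hlim : Filter.Tendsto (fun n : ℕ => q ^ n) Filter.atTop (nhds 0) :=
      tendsto_pow_atTop_nhds_zero_of_abs_lt_one hq
    have hlim' := hlim.comp (Filter.tendsto_add_atTop_nat 1)
    have hw : Filter.Tendsto (fun n : ℕ => s - c * q ^ n) Filter.atTop (nhds s) := by
      simpa using (hlim.const_mul c).const_sub s
    have hw' := hw.comp (Filter.tendsto_add_atTop_nat 1)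
    have ht : Filter.Tendsto (fun n : ℕ => p * (1 - q ^ (n + 1))) Filter.atTop (nhds p) := by
      simpa using (hlim'.const_sub 1).const_mul p
    -- If s = 0, then |t_n| = |w_{n+1} - r_{n+1}| |r_n| ≤ |w_{n+1} w_n| tends to 0, while t_n tends
    -- to p ≠ 0.
    have hs : s ≠ 0 := by
      rintro rfl
      have hle : ∀ n, |p * (1 - q ^ (n + 1))| ≤ |(0 - c * q ^ (n + 1)) * (0 - c * q ^ n)| := by
        intro n
        have a1 := hwr n
        have a2 : p * (1 - q ^ (n + 1)) = ((0 - c * q ^ (n + 1)) - r (n + 1)) * r n := by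
          rw [← hr n]
          have := hr0 n
          field_simp
          ring
        have b : ∀ n, |r n| ≤ |0 - c * q ^ n| := fun n => by
          have h1 := (hwr n).trans (le_abs_self _)
          rw [abs_mul, ← sq_abs, sq] at h1
          exact le_of_mul_le_mul_right h1 (abs_pos.2 (hr0 n))
        rw [a2, abs_mul, abs_mul]
        refine mul_le_mul ?_ (b n) (abs_nonneg _) (abs_nonneg _)
        have b1 := b (n + 1)
        have c1 := hwr' (n + 1)
        rcases mul_pos_iff.1 c1 with ⟨c2, c3⟩ | ⟨c2, c3⟩
        · rw [abs_of_pos c2, abs_of_pos c3] at *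
          rw [abs_le]
          constructor <;> linarith
        · rw [abs_of_neg c2, abs_of_neg c3] at *
          rw [abs_le]
          constructor <;> linarith
      have := le_of_tendsto_of_tendsto' ht.abs (hw'.mul hw).abs hle
      simp only [mul_zero, abs_zero] at this
      exact hp0 (abs_nonpos_iff.1 this)
    have hp : 0 < p := by
      have h1 := ge_of_tendsto' ((ht.mul hw').mul hw) fun n => (htw n).le
      have h2 : 0 < s ^ 2 := sq_pos_of_ne_zero hs
      refine lt_of_le_of_ne ?_ hp0.symm
      refine nonneg_of_mul_nonneg_left (b := s ^ 2) ?_ h2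
      linarith
    refine ⟨fun n => mul_pos hp (sub_pos.2 ((le_abs_self _).trans_lt ?_)), ?_⟩
    · rw [abs_pow]
      exact pow_lt_one₀ (abs_nonneg q) hq (Nat.succ_ne_zero n)
    · have hws : Filter.Tendsto (fun n : ℕ => (s - c * q ^ n) / s) Filter.atTop (nhds 1) := by
        have := hw.div_const s
        rwa [div_self hs] at this
      obtain ⟨N, hN⟩ := Filter.eventually_atTop.1 (hws.eventually_const_lt zero_lt_one)
      have h4 := limit_le_of_positive_recurrence (u := fun n => r n / s) (N := N)
        (t := fun n => p * (1 - q ^ (n + 1)) / s ^ 2) (fun n hn => by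
          have h1 := hwr' n
          have h2 := hN n hn
          have h3 : 0 < (s - c * q ^ n) / s * (r n / s) := by
            rw [div_mul_div_comm]
            exact div_pos h1 (mul_self_pos.2 hs)
          exact (mul_pos_iff_of_pos_left h2).1 h3)
        (fun n => by
          have := hr n
          have := hr0 n
          change r (n + 1) / s + p * (1 - q ^ (n + 1)) / s ^ 2 / (r n / s) =
            ((fun n : ℕ => (s - c * q ^ n) / s) ∘ fun n => n + 1) n
          simp only [Function.comp]
          rw [← hr n]
          field_simp) (hws.comp (Filter.tendsto_add_atTop_nat 1)) (ht.div_const (s ^ 2))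
      rw [← mul_div_assoc, div_le_one (sq_pos_of_ne_zero hs)] at h4
      exact h4
  · have hy : |q⁻¹| < 1 := by
      rw [abs_inv]
      exact inv_lt_one_of_one_lt₀ hq
    have hlim : Filter.Tendsto (fun n : ℕ => q⁻¹ ^ n) Filter.atTop (nhds 0) :=
      tendsto_pow_atTop_nhds_zero_of_abs_lt_one hy
    have hlim' := hlim.comp (Filter.tendsto_add_atTop_nat 1)
    set G : ℕ → ℝ := fun n => p * (q⁻¹ ^ (n + 1) - 1) * (s * q⁻¹ ^ (n + 1) - c) *
      (s * q⁻¹ ^ n - c) with hG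
    have hGlim : Filter.Tendsto G Filter.atTop (nhds (-(p * c ^ 2))) := by
      have := (((hlim'.sub_const 1).const_mul p).mul ((hlim'.const_mul s).sub_const c)).mul
        ((hlim.const_mul s).sub_const c)
      rw [show p * (0 - 1) * (s * 0 - c) * (s * 0 - c) = -(p * c ^ 2) by ring] at this
      exact this
    have hGeq : ∀ n, p * (1 - q ^ (n + 1)) * (s - c * q ^ (n + 1)) * (s - c * q ^ n) =
        G n * q ^ (3 * n + 2) := by
      intro n
      simp only [hG, inv_pow]
      field_simp
      ring
    rcases lt_or_gt_of_ne hq0 with hneg | hqpos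
    · exfalso
      have hq' : q < -1 := by
        rw [abs_of_neg hneg] at hq
        linarith
      -- For q < -1 the factor q^{3n+2} alternates in sign, so G does too and its limit -p c² must
      -- be 0. Then c = 0, and p (1 - q) and p (1 - q²) would both be positive.
      have hprod : ∀ n, G n * G (n + 1) ≤ 0 := by
        intro n
        have h1 := mul_pos (htw n) (htw (n + 1))
        rw [hGeq, hGeq] at h1
        have h2 : 0 < q ^ (2 * (3 * n + 3)) := by
          rw [pow_mul']
          exact sq_pos_of_ne_zero (pow_ne_zero _ hq0)
        have h3 : 0 < (G n * G (n + 1) * q) * q ^ (2 * (3 * n + 3)) := by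
          refine h1.trans_eq ?_
          ring
        have h4 := pos_of_mul_pos_left h3 h2.le
        by_contra! h5
        exact absurd h4 (not_lt.2 (mul_nonpos_of_nonneg_of_nonpos h5.le hneg.le))
      have hl := le_of_tendsto' (hGlim.mul (hGlim.comp (Filter.tendsto_add_atTop_nat 1))) hprod
      have hc : c = 0 := by
        have h1 : p * c ^ 2 = 0 := by nlinarith
        simpa [hp0] using h1
      subst hc
      have z0 := htw 0
      have z1 := htw 1
      simp only [zero_mul, sub_zero, zero_add, pow_one, mul_assoc] at z0 z1
      have h1 : 0 < p * (1 - q) := pos_of_mul_pos_left (b := s * s) (by linarith) (mul_self_nonneg s)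
      have h2 : 0 < p * (1 - q ^ 2) :=
        pos_of_mul_pos_left (b := s * s) (by norm_num at z1 ⊢; linarith) (mul_self_nonneg s)
      nlinarith [mul_pos h1 h2]
    · have hq' : 1 < q := by rwa [abs_of_pos hqpos] at hq
      have hp : p < 0 := by
        refine lt_of_le_of_ne ?_ hp0
        rcases eq_or_ne c 0 with rfl | hc
        · have z0 := htw 0
          simp only [zero_mul, sub_zero, zero_add, pow_one, mul_assoc] at z0
          have h1 : 0 < p * (1 - q) :=
            pos_of_mul_pos_left (b := s * s) (by linarith) (mul_self_nonneg s)
          by_contra! h2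
          nlinarith
        · have h1 := ge_of_tendsto' hGlim fun n => by
            have := htw n
            rw [hGeq] at this
            exact (pos_of_mul_pos_left this (by positivity)).le
          have h2 : 0 < c ^ 2 := sq_pos_of_ne_zero hc
          by_contra! h3
          nlinarith [mul_pos h3 h2]
      refine ⟨fun n => mul_pos_of_neg_of_neg hp (sub_neg.2 (one_lt_pow₀ hq' (Nat.succ_ne_zero n))),
        by nlinarith [sq_nonneg s]⟩

/-! ### Quasi-orthogonal `q`-Appell sets of type II -/

section

variable {q : ℝ} {L : ℝ[X] →ₗ[ℝ] ℝ} {P : ℕ → ℝ[X]}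

theorem map_mul_eq_zero_of_lt (hP : IsPolynomialSet P)
    (horth : ∀ (n : ℕ) (f : ℝ[X]), f.degree < n → L (f * P n) = 0) {m n : ℕ} (h : m < n) :
    L (P m * P n) = 0 :=
  horth n _ (by rw [hP]; exact_mod_cast h)

theorem map_X_mul_mul_eq_zero_of_lt (hP : IsPolynomialSet P)
    (horth : ∀ (n : ℕ) (f : ℝ[X]), f.degree < n → L (f * P n) = 0) {m n : ℕ} (h : m + 1 < n) :
    L (X * P m * P n) = 0 :=
  horth n _ (by
    rw [degree_mul, degree_X, hP, add_comm]
    exact_mod_cast h)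

/-- Orthogonal polynomials with the lowering relation are Al-Salam-Carlitz II polynomials. -/
theorem exists_eq_ascPoly_of_orthogonal (hq0 : q ≠ 0) (hq1 : ∀ n : ℕ, 1 ≤ n → q ^ n ≠ 1)
    (hP : IsPolynomialSet P) (hP0 : P 0 = 1)
    (horth : ∀ (n : ℕ) (f : ℝ[X]), f.degree < n → L (f * P n) = 0)
    (hpos : ∀ n, 0 < L (P n * P n)) (hlow : IsQLowering q P) :
    ∃ s p : ℝ, (∀ n : ℕ, 1 ≤ n → 0 < q * (1 - q ^ n) * p) ∧ ∀ n, P n = ascPoly q s p n := by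
  obtain ⟨h, hh⟩ := hlow.exists_recurrence hq1 hP0
  have hz : ∀ k, h (k + 2) = 0 := by
    intro k
    have := recurrence_coeff_relation hq1 (e := fun _ => 0) hP horth hpos rfl (fun n => by simp) hh
      (j := 0) (k := k + 1) (map_mul_eq_zero_of_lt hP horth (by omega))
      (map_X_mul_mul_eq_zero_of_lt hP horth (by omega))
    rw [mul_zero, add_zero] at this
    exact (mul_eq_zero.1 this).resolve_right (one_sub_pow_ne_zero_of hq1 0)
  have hasc := eq_ascPoly_of_recurrence hq1 hP0 hh hz
  refine ⟨_, _, fun n hn => ?_, hasc⟩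
  obtain ⟨n, rfl⟩ := Nat.exists_eq_add_of_le' hn
  have hrec := ascPoly_succ q (-h 0) (-h 1)
  simp only [← hasc] at hrec
  have e1 : L (P n * P (n + 1 + 1)) = q ^ (n + 1) * L (X * P n * P (n + 1)) -
      -h 0 * L (P n * P (n + 1)) - -h 1 * (1 - q ^ (n + 1)) * L (P n * P n) := by
    rw [hrec (n + 1), Nat.add_sub_cancel, ← map_C_mul, ← map_C_mul, ← map_C_mul, ← map_sub,
      ← map_sub]
    congr 1
    ring
  have e2 : L (P (n + 1) * P (n + 1)) = q ^ n * L (X * P n * P (n + 1)) -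
      -h 0 * L (P n * P (n + 1)) - -h 1 * (1 - q ^ n) * L (P (n - 1) * P (n + 1)) := by
    conv_lhs => rw [hrec n]
    rw [← map_C_mul, ← map_C_mul, ← map_C_mul, ← map_sub, ← map_sub]
    congr 1
    rw [hrec n]
    ring
  rw [map_mul_eq_zero_of_lt hP horth (by omega), map_mul_eq_zero_of_lt hP horth (by omega)] at e1
  rw [map_mul_eq_zero_of_lt hP horth (Nat.lt_succ_self n),
    map_mul_eq_zero_of_lt hP horth (show n - 1 < n + 1 by omega)] at e2
  refine pos_of_mul_pos_left (b := L (P n * P n)) ?_ (hpos n).le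
  have : q * (1 - q ^ (n + 1)) * -h 1 * L (P n * P n) = q ^ 2 * L (P (n + 1) * P (n + 1)) := by
    linear_combination q * e1 - q ^ 2 * e2
  rw [this]
  exact mul_pos (sq_pos_of_ne_zero hq0) (hpos _)

/-- If both the quasi-orthogonal set and its orthogonal part satisfy recurrences of order two, then
the parameters of the quasi-orthogonal set satisfy positivity conditions. -/
theorem ascPoly_parameter_conditions {s p : ℝ} (hq0 : q ≠ 0) (hq1 : q ≠ 1) (hq2 : q ≠ -1)
    (hP : IsPolynomialSet P)
    (horth : ∀ (n : ℕ) (f : ℝ[X]), f.degree < n → L (f * P n) = 0)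
    (hpos : ∀ n, 0 < L (P n * P n)) {e : ℕ → ℝ} (he0 : e 0 = 0) (he : ∀ n, e (n + 1) ≠ 0)
    (hQP : ∀ n, ascPoly q s p n = P n + C (e n) * P (n - 1)) :
    (∀ n, 0 < p * (1 - q ^ (n + 1))) ∧ 4 * p ≤ s ^ 2 := by
  set Q := ascPoly q s p with hQ
  have hrec : ∀ n (f : ℝ[X]), L (f * Q (n + 1)) = q ^ n * L (X * f * Q n) - s * L (f * Q n) -
      p * (1 - q ^ n) * L (f * Q (n - 1)) := fun n f => by
    rw [hQ, ascPoly_succ, ← map_C_mul, ← map_C_mul, ← map_C_mul, ← map_sub, ← map_sub]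
    congr 1
    ring
  have hexp : ∀ n (f : ℝ[X]), L (f * Q n) = L (f * P n) + e n * L (f * P (n - 1)) := fun n f => by
    rw [hQP, mul_add, map_add, mul_left_comm, map_C_mul]
  have hz : ∀ m n, m < n → L (P m * P n) = 0 := fun m n h => map_mul_eq_zero_of_lt hP horth h
  have hz' : ∀ m n, m < n → L (P n * P m) = 0 := fun m n h => by rw [mul_comm]; exact hz m n h
  have hX : ∀ m n, m + 1 < n → L (X * P m * P n) = 0 :=
    fun m n h => map_X_mul_mul_eq_zero_of_lt hP horth h
  have hswap : ∀ m n, L (X * P m * P n) = L (X * P n * P m) := fun m n => by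
    congr 1
    ring
  have hκ := fun n => (hpos n).ne'
  have x : ∀ n, q ^ n * L (X * P n * P (n + 1)) = L (P (n + 1) * P (n + 1)) := by
    intro n
    have h1 := hrec n (P (n + 1))
    rw [hexp, hexp, hexp, hexp, Nat.add_sub_cancel, hz' n (n + 1) (by omega),
      hz' (n - 1) (n + 1) (by omega), hz' (n - 1 - 1) (n + 1) (by omega), hswap (n + 1) n] at h1
    rcases n with _ | n
    · rw [he0] at h1
      linarith
    · rw [Nat.add_sub_cancel, hswap (n + 1 + 1) n, hX n (n + 1 + 1) (by omega)] at h1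
      linarith
  -- Pairing the recurrence for Q with P_n at consecutive indices gives `i1`, `i3` and `i2`,
  -- relations between e and the norms of P.
  have i1 : ∀ n, p * (1 - q ^ (n + 2)) * e (n + 1) * L (P n * P n) =
      q ^ 2 * e (n + 2) * L (P (n + 1) * P (n + 1)) := by
    intro n
    have h1 := hrec (n + 2) (P n)
    rw [hexp, hexp, hexp, hexp, show n + 2 + 1 - 1 = n + 2 by omega,
      show n + 2 - 1 = n + 1 by omega, Nat.add_sub_cancel, hz n (n + 2 + 1) (by omega),
      hz n (n + 2) (by omega), hz n (n + 1) (by omega), hX n (n + 2) (by omega)] at h1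
    linear_combination h1 + q ^ 2 * e (n + 2) * x n
  have i3 : ∀ n, q ^ n * L (X * P n * P n) =
      (e (n + 1) - q * e n + s) * L (P n * P n) := by
    intro n
    have h1 := hrec n (P n)
    rw [hexp, hexp, hexp, hexp, Nat.add_sub_cancel, hz n (n + 1) (by omega)] at h1
    rcases n with _ | n
    · rw [he0] at h1 ⊢
      simp at h1 ⊢
      linarith
    · rw [Nat.add_sub_cancel, hz' n (n + 1) (by omega), hz' (n - 1) (n + 1) (by omega),
        hswap (n + 1) n] at h1
      linear_combination -h1 + -(q * e (n + 1)) * x n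
  have i2 : ∀ n, q * L (P (n + 1) * P (n + 1)) +
      q * e (n + 1) * (e (n + 1) - q * e n + s) * L (P n * P n) =
      (s * e (n + 1) + p * (1 - q ^ (n + 1))) * L (P n * P n) := by
    intro n
    have h1 := hrec (n + 1) (P n)
    have h2 : L (P n * Q n) = L (P n * P n) := by
      rw [hexp]
      rcases n with _ | n
      · rw [he0, zero_mul, add_zero]
      · rw [Nat.add_sub_cancel, hz' n (n + 1) (by omega), mul_zero, add_zero]
    rw [hexp, hexp, hexp, Nat.add_sub_cancel, Nat.add_sub_cancel, h2, hz n (n + 1 + 1) (by omega),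
      hz n (n + 1) (by omega)] at h1
    linear_combination -h1 - q * x n - q * e (n + 1) * i3 n
  have htee : ∀ n, 0 < p * (1 - q ^ (n + 2)) * e (n + 1) * e (n + 2) := by
    intro n
    have h1 : 0 < q ^ 2 * e (n + 2) ^ 2 * L (P (n + 1) * P (n + 1)) :=
      mul_pos (mul_pos (sq_pos_of_ne_zero hq0) (sq_pos_of_ne_zero (he (n + 1)))) (hpos _)
    refine pos_of_mul_pos_left (b := L (P n * P n)) ?_ (hpos n).le
    refine h1.trans_eq ?_
    linear_combination -e (n + 2) * i1 n
  have hp : p ≠ 0 := fun h => by simpa [h] using htee 0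
  have ht : ∀ n, p * (1 - q ^ (n + 1)) ≠ 0 := by
    intro n
    rcases n with _ | n
    · rw [zero_add, pow_one]
      exact mul_ne_zero hp (sub_ne_zero.2 hq1.symm)
    · exact left_ne_zero_of_mul (left_ne_zero_of_mul (htee n).ne')
  set r : ℕ → ℝ := fun n => p * (1 - q ^ (n + 1)) / (q * e (n + 1)) with hr
  -- Eliminating the norms leaves a relation in e alone, which becomes geometric in r_n + q e_n - s;
  -- with e_0 = 0 it can be solved explicitly.
  have hstep : ∀ n, r (n + 1) + q * e (n + 1) - s = q * (r n + q * e n - s) := by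
    intro n
    have h1 := he n
    have h2 : e (n + 2) ≠ 0 := he (n + 1)
    have h3 := hκ n
    have key : p * (1 - q ^ (n + 2)) * e (n + 1) +
        q ^ 2 * e (n + 2) * e (n + 1) * (e (n + 1) - q * e n + s) =
        q * e (n + 2) * (s * e (n + 1) + p * (1 - q ^ (n + 1))) := by
      refine mul_right_cancel₀ h3 ?_
      linear_combination q * e (n + 2) * i2 n + i1 n
    change p * (1 - q ^ (n + 2)) / (q * e (n + 2)) + q * e (n + 1) - s =
      q * (p * (1 - q ^ (n + 1)) / (q * e (n + 1)) + q * e n - s)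
    field_simp
    linear_combination key
  have hclosed : ∀ n, r n + q * e n = s - (s - r 0) * q ^ n := by
    intro n
    induction n with
    | zero => rw [he0]; ring
    | succ n ih => linear_combination hstep n + q * ih
  refine sign_of_positive_recurrence (r := r) (c := s - r 0) hq0 hq1 hq2 (by ring) (fun n => ?_)
    fun n => ?_
  · rw [← hclosed]
    have : p * (1 - q ^ (n + 1)) / r n = q * e (n + 1) := by
      have h1 := left_ne_zero_of_mul (ht n)
      have h2 := right_ne_zero_of_mul (ht n)
      have h3 := he n
      simp only [hr]
      field_simp
    rw [this]
  · have h1 : p * (1 - q ^ (n + 1)) * r (n + 1) * r n =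
        (p * (1 - q ^ (n + 1))) ^ 2 * (p * (1 - q ^ (n + 2)) * e (n + 1) * e (n + 2)) /
          (q * e (n + 1) * e (n + 2)) ^ 2 := by
      have h1 := he n
      have h2 : e (n + 2) ≠ 0 := he (n + 1)
      change p * (1 - q ^ (n + 1)) * (p * (1 - q ^ (n + 2)) / (q * e (n + 2))) *
        (p * (1 - q ^ (n + 1)) / (q * e (n + 1))) = _
      field_simp
    rw [h1]
    exact div_pos (mul_pos (sq_pos_of_ne_zero (ht n)) (htee n)) (sq_pos_of_ne_zero
      (mul_ne_zero (mul_ne_zero hq0 (he n)) (he (n + 1))))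

end

theorem exists_ascPoly_of_functional {q : ℝ} (hq0 : q ≠ 0) (hq1 : q ≠ 1) (hq2 : q ≠ -1)
    (hpow : ∀ n : ℕ, 1 ≤ n → q ^ n ≠ 1) {Q : ℕ → ℝ[X]} (hQ : IsPolynomialSet Q) (hQ0 : Q 0 = 1)
    (hlow : IsQLowering q Q) {L : ℝ[X] →ₗ[ℝ] ℝ} (hL : ∀ f, 0 ≤ L (f * f))
    (h0 : ∀ m n : ℕ, m + 2 ≤ n → L (X ^ m * Q n) = 0)
    (h1 : ∀ m n : ℕ, m + 1 = n → L (X ^ m * Q n) ≠ 0) :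
    ∃ s p a : ℝ, a ≠ 0 ∧ (∀ n : ℕ, 1 ≤ n → 0 < q * (1 - q ^ n) * p) ∧
      ∀ n, Q n = ascPoly q s p n + C (a * (1 - q ^ n)) * ascPoly q s p (n - 1) := by
  obtain ⟨P, e, hP, hP0, he0, hQP, he, horth, hpos⟩ :=
    exists_orthogonal_of_quasiOrthogonal hL hQ h0 h1
  rw [hQ0] at hP0
  obtain ⟨h, hh⟩ := hlow.exists_recurrence hpow hQ0
  -- The index of h starts at 2 because X P_j has degree j + 1, and Q_n is guaranteed to annihilate
  -- it only for n ≥ j + 3.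
  have hrel : ∀ j k, h (k + 3) * (1 - q ^ (j + 1)) + h (k + 2) * e (j + 1) = 0 := fun j k =>
    recurrence_coeff_relation hpow hP horth hpos he0 hQP hh
      (map_mul_eq_zero_of_degree_lt (n := j + 1) (fun m hm => h0 m _ (by omega))
        (by rw [hP]; exact_mod_cast Nat.lt_succ_self j))
      (map_mul_eq_zero_of_degree_lt (n := j + 2) (fun m hm => h0 m _ (by omega))
        (by
          rw [degree_mul, degree_X, hP]
          exact_mod_cast (by omega : 1 + j < j + 2)))
  rcases eq_or_ne (h 2) 0 with h2 | h2
  · have hz : ∀ k, h (k + 2) = 0 := by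
      intro k
      induction k with
      | zero => exact h2
      | succ k ih =>
        have := hrel 0 k
        rw [ih, zero_mul, add_zero] at this
        exact (mul_eq_zero.1 this).resolve_right (one_sub_pow_ne_zero_of hpow 0)
    have hasc := eq_ascPoly_of_recurrence hpow hQ0 hh hz
    set s := -h 0
    set p := -h 1
    obtain ⟨hp, hsp⟩ := ascPoly_parameter_conditions hq0 hq1 hq2 hP horth hpos he0 he
      (fun n => (hasc n).symm.trans (hQP n))
    -- The real roots (s ± d) / 2 of t² - s t + p are to be qa and b in the parameter shift. The
    -- resulting P need not be the orthogonal part for the given L.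
    have hd : √(s ^ 2 - 4 * p) ^ 2 = s ^ 2 - 4 * p := Real.sq_sqrt (by linarith)
    set d := √(s ^ 2 - 4 * p)
    have hp0 : p ≠ 0 := left_ne_zero_of_mul (hp 0).ne'
    have hs : q * ((s + d) / 2 / q) + (s - d) / 2 = s := by
      field_simp
      ring
    have hpe : q * ((s + d) / 2 / q * ((s - d) / 2)) = p := by
      field_simp
      linear_combination -hd
    have ha : (s + d) / 2 / q ≠ 0 := by
      intro h
      rw [h] at hpe
      exact hp0 (by rw [← hpe]; ring)
    refine ⟨(s + d) / 2 / q + (s - d) / 2, (s + d) / 2 / q * ((s - d) / 2), (s + d) / 2 / q, ha,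
      fun n hn => ?_, fun n => ?_⟩
    · obtain ⟨n, rfl⟩ := Nat.exists_eq_add_of_le' hn
      have := hp n
      rw [← hpe] at this
      linarith
    · rw [hasc n, ← ascPoly_shift, hs, hpe]
  · set a := -(h 3 / h 2) with ha
    have hea : ∀ n, e n = a * (1 - q ^ n) := by
      intro n
      rcases n with _ | n
      · rw [he0]
        simp
      · have := hrel n 0
        simp only [zero_add] at this
        rw [ha]
        field_simp
        linear_combination this
    have ha0 : a ≠ 0 := by
      have := he 0
      rw [hea] at this
      exact left_ne_zero_of_mul this
    have hPlow : IsQLowering q P := by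
      intro n
      induction n with
      | zero => simp [hP0]
      | succ n ih =>
        intro x
        have e1 := hlow (n + 1) x
        have e2 := ih x
        rw [Nat.add_sub_cancel, hQP (n + 1), hQP n, hea, hea, Nat.add_sub_cancel] at e1
        simp only [eval_add, eval_mul, eval_C, Nat.add_sub_cancel] at e1 ⊢
        linear_combination e1 - a * (1 - q ^ (n + 1)) * e2
    obtain ⟨s, p, hsp, hasc⟩ := exists_eq_ascPoly_of_orthogonal hq0 hpow hP hP0 horth hpos hPlow
    exact ⟨s, p, a, ha0, hsp, fun n => by rw [hQP n, hea, hasc, hasc]⟩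

theorem isQuasiOrthogonal_of_ascPoly {q s p a : ℝ} (hq0 : q ≠ 0)
    (hpow : ∀ n : ℕ, 1 ≤ n → q ^ n ≠ 1) (ha : a ≠ 0)
    (hpos : ∀ n : ℕ, 1 ≤ n → 0 < q * (1 - q ^ n) * p) {Q : ℕ → ℝ[X]} (hQ : IsPolynomialSet Q)
    (hQ0 : Q 0 = 1)
    (hQA : ∀ n, Q n = ascPoly q s p n + C (a * (1 - q ^ n)) * ascPoly q s p (n - 1)) :
    IsQuasiOrthogonal Q := by
  obtain ⟨L, hL1, hL, h0, h1⟩ := exists_functional_ascPoly (s := s) hq0 hpos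
  have hexp : ∀ m n, L (X ^ m * Q n) = L (X ^ m * ascPoly q s p n) +
      a * (1 - q ^ n) * L (X ^ m * ascPoly q s p (n - 1)) := fun m n => by
    rw [hQA, mul_add, map_add, mul_left_comm, map_C_mul]
  refine isQuasiOrthogonal_of_functional hQ hQ0 hL1 hL (fun m n hmn => ?_) fun m n hmn => ?_
  · rw [hexp, h0 m n (by omega), h0 m (n - 1) (by omega), mul_zero, add_zero]
  · subst hmn
    rw [hexp, h0 m (m + 1) (by omega), zero_add, Nat.add_sub_cancel]
    exact mul_ne_zero (mul_ne_zero ha (one_sub_pow_ne_zero_of hpow m)) (h1 m)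

/-- Complex numbers with given real sum and product. -/
theorem exists_add_eq_mul_eq (s p : ℝ) : ∃ α β : ℂ, α + β = s ∧ α * β = p := by
  obtain ⟨d, hd⟩ := IsAlgClosed.exists_pow_nat_eq ((s : ℂ) ^ 2 - 4 * p) (n := 2) (by norm_num)
  exact ⟨(s + d) / 2, (s - d) / 2, by ring, by linear_combination -hd / 4⟩

theorem mainTheorem3 (q : ℝ) (hq0 : q ≠ 0) (hq1 : q ≠ 1) (hq2 : q ≠ -1)
    (Q : ℕ → ℝ[X]) (hQ : IsPolynomialSet Q) (hQ0 : Q 0 = 1) :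
    (IsQuasiOrthogonal Q ∧ IsQAppellII q Q) ↔
      ∃ (α β : ℂ) (lam : ℝ),
        β ≠ 0 ∧ lam ≠ 0 ∧ (α + β).im = 0 ∧ (α * β).im = 0 ∧
        (∀ n : ℕ, 1 ≤ n → 0 < q * (1 - q ^ n) * (α * β).re) ∧
        ∀ n : ℕ, 1 ≤ n → ∀ x : ℝ,
          (((Q n).eval x : ℝ) : ℂ) =
            β ^ n * (q : ℂ) ^ n.choose 2 * alSalamCarlitzII (α / β) n ((x : ℂ) / β) (q : ℂ) -
              β ^ (n - 1) * (q : ℂ) ^ (n - 1).choose 2 * ((qNumber q n / lam : ℝ) : ℂ) *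
                alSalamCarlitzII (α / β) (n - 1) ((x : ℂ) / β) (q : ℂ) := by
  have hpow : ∀ n : ℕ, 1 ≤ n → q ^ n ≠ 1 := by
    intro n hn h
    rcases (pow_eq_one_iff_of_ne_zero (by omega)).1 h with h | ⟨h, -⟩
    · exact hq1 h
    · exact hq2 h
  have h1q : 1 - q ≠ 0 := sub_ne_zero.2 hq1.symm
  rw [isQAppellII_iff hq1 hQ]
  constructor
  · rintro ⟨hqo, hlow⟩
    obtain ⟨L, -, hL, h0, h1⟩ := hqo.exists_functional
    obtain ⟨s, p, a, ha, hpos, hQA⟩ :=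
      exists_ascPoly_of_functional hq0 hq1 hq2 hpow hQ hQ0 hlow hL h0 h1
    obtain ⟨α, β, hs, hp⟩ := exists_add_eq_mul_eq s p
    have hp0 : α * β ≠ 0 := by
      rw [hp]
      exact_mod_cast right_ne_zero_of_mul (hpos 1 le_rfl).ne'
    have hα := left_ne_zero_of_mul hp0
    have hβ := right_ne_zero_of_mul hp0
    -- This λ solves [n]_q / λ = -a (1 - q^n).
    refine ⟨α, β, -(a * (1 - q))⁻¹, hβ, neg_ne_zero.2 (inv_ne_zero (mul_ne_zero ha h1q)),
      by rw [hs, Complex.ofReal_im], by rw [hp, Complex.ofReal_im], fun n hn => ?_,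
      fun n hn x => ?_⟩
    · rw [hp, Complex.ofReal_re]
      exact hpos n hn
    · rw [mul_right_comm _ ((qNumber q n / -(a * (1 - q))⁻¹ : ℝ) : ℂ),
        alSalamCarlitzII_eq_ascPoly hq0 hpow hα hβ hs hp,
        alSalamCarlitzII_eq_ascPoly hq0 hpow hα hβ hs hp, hQA]
      have : qNumber q n / -(a * (1 - q))⁻¹ = -(a * (1 - q ^ n)) := by
        rw [qNumber]
        field_simp
      rw [this]
      simp only [eval_add, eval_mul, eval_C]
      push_cast
      ring
  · rintro ⟨α, β, lam, hβ, hlam, hs, hp, hpos, hQV⟩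
    have hα : α ≠ 0 := by
      rintro rfl
      simpa using hpos 1 le_rfl
    have hs' : α + β = ((α + β).re : ℝ) := Complex.ext rfl (by rw [hs, Complex.ofReal_im])
    have hp' : α * β = ((α * β).re : ℝ) := Complex.ext rfl (by rw [hp, Complex.ofReal_im])
    set s := (α + β).re
    set p := (α * β).re
    have ha : -((1 - q) * lam)⁻¹ ≠ 0 := neg_ne_zero.2 (inv_ne_zero (mul_ne_zero h1q hlam))
    have hQA : ∀ n, Q n = ascPoly q s p n +
        C (-((1 - q) * lam)⁻¹ * (1 - q ^ n)) * ascPoly q s p (n - 1) := by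
      intro n
      rcases n with _ | n
      -- Condition 2 says nothing at n = 0; the normalisation Q_0 = 1 covers it, as the lower term
      -- has coefficient 0.
      · simp [hQ0, ascPoly]
      · refine Polynomial.funext fun x => ?_
        have h := hQV (n + 1) (by omega) x
        rw [mul_right_comm _ ((qNumber q (n + 1) / lam : ℝ) : ℂ),
          alSalamCarlitzII_eq_ascPoly hq0 hpow hα hβ hs' hp',
          alSalamCarlitzII_eq_ascPoly hq0 hpow hα hβ hs' hp'] at h
        have h' : (Q (n + 1)).eval x = (ascPoly q s p (n + 1)).eval x -
            (ascPoly q s p (n + 1 - 1)).eval x * (qNumber q (n + 1) / lam) := by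
          exact_mod_cast h
        rw [h', qNumber]
        simp only [eval_add, eval_mul, eval_C]
        field_simp
        ring
    exact ⟨isQuasiOrthogonal_of_ascPoly hq0 hpow ha hpos hQ hQ0 hQA,
      (isQLowering_ascPoly q s p).add_lower hQA⟩
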